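/- Write points of $\mathbb{R}^3$ as $\mathbf r=(\rho\cos\varphi,\rho\sin\varphi,z)=r(\sin\theta\cos\varphi,\sin\theta\sin\varphi,\cos\theta)$, and mark the coordinates of $\mathbf x,\mathbf y$ by subscripts. For $R>0$ let $S_R=\{\mathbf x'=(x',y',0):|\mathbf x'|\ge R\}$ with surface element $dS=dx'\,dy'$ and upward normal, let $G(\mathbf y,\mathbf x)=\frac{1}{4\pi|\mathbf y-\mathbf x|}$, and let $$K^{(D)}(\mathbf y,\mathbf x;R)=-2\int_{S_R}G(\mathbf x',\mathbf x)\,\frac{\partial G(\mathbf y,\mathbf x')}{\partial z'}\Big|_{z'=0}\,dS(\mathbf x').$$ Let $$\widetilde K^{(D)}(\mathbf y,\mathbf x)=-\frac{z_y}{8\pi^2}\int_0^{2\pi}\!\!\int_0^1\frac{\eta\,d\eta\,d\varphi'}{Q(\eta,\varphi'-\varphi_y,\rho_y,r_y)^3\,Q(\eta,\varphi'-\varphi_x,\rho_x,r_x)},\qquad Q(\eta,\varphi,\rho,r)=(r^2\eta^2-2\rho\eta\cos\varphi+1)^{1/2}.$$ For $n\ge 0$ and $|m|\le n$ put $$Y_n^m(\theta,\varphi)=N_n^mP_n^{|m|}(\cos\theta)e^{im\varphi},\quad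 N_n^m=(-1)^m\sqrt{\tfrac{2n+1}{4\pi}\tfrac{(n-|m|)!}{(n+|m|)!}},\quad P_n^m(\xi)=\frac{(-1)^m(1-\xi^2)^{m/2}}{2^nn!}\frac{d^{n+m}}{d\xi^{n+m}}(\xi^2-1)^n,$$ $R_n^m(\mathbf r)=r^nY_n^m(\theta,\varphi)$, $S_n^m(\mathbf r)=r^{-n-1}Y_n^m(\theta,\varphi)$, $L_n^m=N_n^mP_n^{|m|}(0)=Y_n^m(\pi/2,0)$, and $$a_n^m=\sqrt{\tfrac{(n+1+m)(n+1-m)}{(2n+1)(2n+3)}}\ \ (n\ge|m|),\qquad a_n^m=0\ \ (n<|m|),$$ $$J^m_{nn'}=\frac{4\pi\,a_n^mL_{n+1}^mL_{n'}^m}{(2n'+1)(n+n'+1)},\qquad I^m_{nn'}=J^m_{nn'}R^{-n-n'-1}.$$ Let $l_n^m=1$ if $n+m$ is even and $l_n^m=0$ if $n+m$ is odd. Then the following hold. 1. For $|m|\le n$: $Y_n^m(\pi/2,\varphi)=L_n^me^{im\varphi}$ for all $\varphi$, $\;L_n^m=l_n^m\dfrac{(-1)^{(n+|m|)/2}(n+|m|)!}{2^n\left(\frac{n-|m|}{2}\right)!\left(\frac{n+|m|}{2}\right)!}N_n^m$,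 and $L_n^mL_{n+1}^m=0$. 2. Let $R>0$, $|\mathbf x|<R$, $|\mathbf y|<R$. The integral defining $K^{(D)}(\mathbf y,\mathbf x;R)$ converges absolutely, and $$K^{(D)}(\mathbf y,\mathbf x;R)=\sum_{n=0}^\infty\sum_{m=-n}^n\sum_{n'=0}^\infty\sum_{m'=-n'}^{n'}\frac{2a_{n'}^{m'}}{2n+1}R_n^{-m}(\mathbf x)R_{n'}^{-m'}(\mathbf y)\int_{S_R}S_{n'+1}^{m'}S_n^m\,dS$$ $$=\sum_{n=0}^\infty\sum_{m=-n}^n\sum_{n'=0}^\infty I^m_{n'n}R_n^{-m}(\mathbf x)R_{n'}^m(\mathbf y)=\sum_{m=-\infty}^\infty\sum_{n=|m|+1}^\infty\sum_{n'=|m|}^\infty I^m_{nn'}R_{n'}^{-m}(\mathbf x)R_n^m(\mathbf y),$$ where all these series converge, the last one absolutely as a series over the triples $(m,n,n')$. Moreover $K^{(D)}(\mathbf y,\mathbf x;R)=\frac1R\widetilde K^{(D)}(\mathbf y/R,\mathbf x/R)$. 3. Let $|\mathbf x|<1$, $|\mathbf y|<1$. Then, with convergent series, $$\widetilde K^{(D)}(\mathbf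 y,\mathbf x)=\sum_{n=0}^\infty\sum_{m=-n}^nU_n^m(\mathbf x)R_n^m(\mathbf y),\qquad U_n^m(\mathbf x)=\sum_{n'=|m|}^\infty J^m_{nn'}R_{n'}^{-m}(\mathbf x),$$ and in real form $$\widetilde K^{(D)}(\mathbf y,\mathbf x)=\sum_{n=0}^\infty\sum_{m=-n}^n\underline{U}_n^m(\mathbf x)\underline{R}_n^m(\mathbf y),\qquad \underline{U}_n^m(\mathbf x)=-\frac{2-\delta_{m0}}{4\pi}\nu_{n+1}^m\sum_{n'=|m|}^\infty\frac{\nu_{n'}^m}{n'+n+1}\underline{R}_{n'}^m(\mathbf x),$$ where $\underline{R}_n^m(\mathbf r)=\frac{(-1)^{n+m}}{(n+|m|)!}r^nP_n^{|m|}(\cos\theta)\cos m\varphi$ for $m\ge0$, the same with $\sin m\varphi$ in place of $\cos m\varphi$ for $m<0$, and $\nu_n^m=l_n^m(-1)^{(n+|m|)/2}(n-|m|-1)!!\,(n+|m|-1)!!$ with $(-1)!!=1$. 4. Let $R>0$. For $n,n'\ge|m|$: $I^{-m}_{nn'}=I^m_{nn'}$, $I^m_{|m|\,n'}=0$ and $I^m_{n'n}I^m_{nn'}=0$,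 so that $I^m_{n'n}\ne I^m_{nn'}$ whenever $I^m_{n'n}\ne0$; for every $m$ there are $n,n'\ge|m|$ with $I^m_{n'n}\neq 0$, and hence $I^m_{n'n}\ne I^m_{nn'}$. The kernel is not symmetric: there are $\mathbf x,\mathbf y$ in the ball $|\mathbf r|<R$ with $K^{(D)}(\mathbf y,\mathbf x;R)\ne K^{(D)}(\mathbf x,\mathbf y;R)$. -/

import Mathlib

open MeasureTheory

noncomputable section

namespace GroundPlane

/-- Euclidean three-space. -/
abbrev E3 : Type := EuclideanSpace ℝ (Fin 3)

/-- Distance to the vertical axis. -/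
def rho (v : E3) : ℝ := Real.sqrt (v 0 ^ 2 + v 1 ^ 2)

/-- Azimuth `φ`, so that `v 0 = rho v * cos φ` and `v 1 = rho v * sin φ`. -/
def azimuth (v : E3) : ℝ := Complex.arg ⟨v 0, v 1⟩

/-- Polar angle `θ`, so that `v 2 = ‖v‖ * cos θ`. -/
def polarAngle (v : E3) : ℝ := Real.arccos (v 2 / ‖v‖)

/-! ### The kernel -/

/-- Free-space Green's function of the Laplace equation. -/
def greenFn (y x : E3) : ℝ := 1 / (4 * Real.pi * ‖y - x‖)

/-- The set of `(x', y')` such that `(x', y', 0)` lies on the ground plane outside the open ball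
of radius `R`. The surface element there is Lebesgue measure `dx' dy'`. -/
def groundSet (R : ℝ) : Set (ℝ × ℝ) := {p | R ^ 2 ≤ p.1 ^ 2 + p.2 ^ 2}

/-- The point of the horizontal plane at height `t` above `p`. -/
def planePoint (p : ℝ × ℝ) (t : ℝ) : E3 := !₂[p.1, p.2, t]

/-- Derivative of `G(y, x')` with respect to `x'` in the direction of the upward normal,
at the ground point `x' = (p, 0)`. -/
def greenNormalDeriv (y : E3) (p : ℝ × ℝ) : ℝ := deriv (fun t => greenFn y (planePoint p t)) 0

/-- Double layer density that produces the boundary value `-G(·, x)` on the upper side. -/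
def layerDensity (p : ℝ × ℝ) (x : E3) : ℝ := -2 * greenFn (planePoint p 0) x

/-- Integrand of the double layer potential. -/
def kernelIntegrand (y x : E3) (p : ℝ × ℝ) : ℝ := layerDensity p x * greenNormalDeriv y p

/-- The kernel `K(y, x; R)`: the double layer potential at `y`, over the part of the plane `z = 0`
outside the ball of radius `R`, with density `-2 G(·, x)`. -/
def kernelD (R : ℝ) (y x : E3) : ℝ := ∫ p in groundSet R, kernelIntegrand y x p

/-- `Q(η, φ, ρ, r, R) = (r² η² - 2 R ρ η cos φ + R²)^(1/2)`. -/
def kernelQ (η φ ρ r R : ℝ) : ℝ :=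
  Real.sqrt (r ^ 2 * η ^ 2 - 2 * R * ρ * η * Real.cos φ + R ^ 2)

/-- The dimensionless kernel, as a double integral. -/
def kernelTilde (y x : E3) : ℝ :=
  -(y 2) / (8 * Real.pi ^ 2) *
    ∫ φ in (0 : ℝ)..(2 * Real.pi), ∫ η in (0 : ℝ)..1,
      η / (kernelQ η (φ - azimuth y) (rho y) ‖y‖ 1 ^ 3 * kernelQ η (φ - azimuth x) (rho x) ‖x‖ 1)

/-! ### Spherical harmonics -/

/-- Associated Legendre function (with the factor `(-1)^m`), by Rodrigues' formula
`P_n^m(ξ) = (-1)^m (1 - ξ²)^(m/2) / (2^n n!) · d^(n+m)/dξ^(n+m) (ξ² - 1)^n`. -/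
def legendreP (n m : ℕ) (ξ : ℝ) : ℝ :=
  (-1) ^ m * Real.sqrt (1 - ξ ^ 2) ^ m / (2 ^ n * (n.factorial : ℝ)) *
    (Polynomial.derivative^[n + m] ((Polynomial.X ^ 2 - 1) ^ n : Polynomial ℝ)).eval ξ

/-- Normalizing constant `N_n^m` (used for `|m| ≤ n`). -/
def normConst (n : ℕ) (m : ℤ) : ℝ :=
  (-1) ^ m.natAbs * Real.sqrt ((2 * n + 1) / (4 * Real.pi) *
    (((n - m.natAbs).factorial : ℝ) / ((n + m.natAbs).factorial : ℝ)))

/-- Orthonormal spherical harmonic `Y_n^m(θ, φ)`. -/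
def sphY (n : ℕ) (m : ℤ) (θ φ : ℝ) : ℂ :=
  ((normConst n m * legendreP n m.natAbs (Real.cos θ) : ℝ) : ℂ) *
    Complex.exp (Complex.I * (m : ℂ) * (φ : ℂ))

/-- Regular solid harmonic `R_n^m(v) = r^n Y_n^m(θ, φ)`. -/
def regR (n : ℕ) (m : ℤ) (v : E3) : ℂ :=
  ((‖v‖ ^ n : ℝ) : ℂ) * sphY n m (polarAngle v) (azimuth v)

/-- Singular solid harmonic `S_n^m(v) = r^(-n-1) Y_n^m(θ, φ)`. -/
def singS (n : ℕ) (m : ℤ) (v : E3) : ℂ :=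
  (((‖v‖ ^ (n + 1))⁻¹ : ℝ) : ℂ) * sphY n m (polarAngle v) (azimuth v)

/-! ### Expansion coefficients -/

/-- `a_n^m`, equal to zero for `n < |m|`. -/
def coefA (n : ℕ) (m : ℤ) : ℝ :=
  if m.natAbs ≤ n then
    Real.sqrt (((n : ℝ) + 1 + m) * ((n : ℝ) + 1 - m) / ((2 * n + 1) * (2 * n + 3)))
  else 0

/-- `L_n^m = N_n^m P_n^|m|(0)`, the value of `Y_n^m` at `θ = π/2`, `φ = 0`. -/
def coefL (n : ℕ) (m : ℤ) : ℝ := normConst n m * legendreP n m.natAbs 0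

/-- `l_n^m`: one if `n + m` is even, zero if `n + m` is odd. -/
def parityL (n : ℕ) (m : ℤ) : ℝ := if Even ((n : ℤ) + m) then 1 else 0

/-- `J^m_{n n'}`. -/
def coefJ (m : ℤ) (n n' : ℕ) : ℝ :=
  4 * Real.pi * coefA n m * coefL (n + 1) m * coefL n' m /
    ((2 * (n' : ℝ) + 1) * ((n : ℝ) + n' + 1))

/-- `I^m_{n n'} = J^m_{n n'} R^(-n-n'-1)`. -/
def coefI (R : ℝ) (m : ℤ) (n n' : ℕ) : ℝ := coefJ m n n' * (R ^ (n + n' + 1))⁻¹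

/-- Summands of `U_n^m(x)`; here `n' = |m| + k` with `k = 0, 1, 2, …`. -/
def termU (n : ℕ) (m : ℤ) (x : E3) (k : ℕ) : ℂ :=
  (coefJ m n (m.natAbs + k) : ℂ) * regR (m.natAbs + k) (-m) x

/-- `U_n^m(x) = ∑_{n' ≥ |m|} J^m_{n n'} R_{n'}^{-m}(x)`. -/
def coefU (n : ℕ) (m : ℤ) (x : E3) : ℂ := ∑' k : ℕ, termU n m x k

/-! ### Real form -/

/-- Real regular solid harmonics. -/
def realR (n : ℕ) (m : ℤ) (v : E3) : ℝ :=
  (-1) ^ (n + m.natAbs) / ((n + m.natAbs).factorial : ℝ) * ‖v‖ ^ n *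
    legendreP n m.natAbs (Real.cos (polarAngle v)) *
    (if 0 ≤ m then Real.cos (m * azimuth v) else Real.sin (m * azimuth v))

/-- `ν_n^m = l_n^m (-1)^((n+|m|)/2) (n-|m|-1)!! (n+|m|-1)!!` for `|m| ≤ n`, with `(-1)!! = 1`
(the natural-number value `0 - 1 = 0` gives `0!! = 1` as required). -/
def coefNu (n : ℕ) (m : ℤ) : ℝ :=
  parityL n m * (-1) ^ ((n + m.natAbs) / 2) *
    (Nat.doubleFactorial (n - m.natAbs - 1) : ℝ) * (Nat.doubleFactorial (n + m.natAbs - 1) : ℝ)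

/-- Summands of the series in the real coefficient; here `n' = |m| + k`. -/
def termRealU (n : ℕ) (m : ℤ) (x : E3) (k : ℕ) : ℝ :=
  coefNu (m.natAbs + k) m / (((m.natAbs + k : ℕ) : ℝ) + n + 1) * realR (m.natAbs + k) m x

/-- Real coefficient
`-(2 - δ_{m0}) / (4π) · ν_{n+1}^m ∑_{n' ≥ |m|} ν_{n'}^m / (n' + n + 1) · realR n' m x`. -/
def realU (n : ℕ) (m : ℤ) (x : E3) : ℝ :=
  -((2 - if m = 0 then 1 else 0) / (4 * Real.pi)) * coefNu (n + 1) m * ∑' k : ℕ, termRealU n m x k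

end GroundPlane

end

open GroundPlane

/-!
The kernel is an integral over the part of the plane `z = 0` outside the ball of radius `R`. At a
point `x'` of that plane with polar coordinates `s`, `φ` its integrand is, up to a constant, the
product of `1 / |x' - x|` and `z_y / |x' - y| ^ 3`. With `t = 1 / s` both factors are, up to powers
of `t`, values of the generating function `(-t z) ^ ε * |e_φ - t v| ^ (-1 - 2 ε)` with `ε = 0` or
`ε = 1`, where `e_φ` is the horizontal unit vector of azimuth `φ`. The expansion of this function in powers of `t` and in Fourier modes of `φ` is the
addition theorem for solid harmonics at the equator (`ε = 0`) and its normal derivative (`ε = 1`).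

The expansion is obtained by comparing coefficients. Put `w = v_0 + i v_1` and `W = w e^(-i φ)`, so
that `|e_φ - t v| ^ 2 = |1 - t W| ^ 2 + t ^ 2 z ^ 2`.

* For small `t`, three binomial series give an absolutely convergent expansion in the monomials
  `z ^ c * W ^ a * (conj W) ^ b` (`hasSum_tripleTerm`). Rodrigues' formula, read as a Taylor
  coefficient of `((ξ + h) ^ 2 - 1) ^ n`, shows that the solid harmonics are explicit sums of the
  same monomials (`solidH_eq`), and the coefficients match (`equatorCoef_eq`).
* Writing `|1 - t W| ^ 2 + t ^ 2 z ^ 2 = |1 - t μ| ^ 2` with `|μ| = |v|` and multiplying the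
  binomial series of the two conjugate factors gives the expansion for all `t |v| < 1`, with coefficients of
  size at most `(n + 1) ^ 3 |v| ^ n` (`hasSum_shiftGegen`, `norm_gegen_le`).

Power series in `t` are unique, so the two expansions agree (`equatorPoly_eq`), and every Fourier
coefficient is bounded by the supremum of the trigonometric sum (`norm_fourierC_le`). This yields an
absolutely convergent expansion over degree and order (`hasSum_fourierC`).

The product of the two expansions converges absolutely and uniformly, relative to `s ^ (-3)`, on the
domain of integration, so it may be integrated termwise (`hasSum_integral_productTerm`). The surface
integrals vanish unless `m' = -m` (`integral_singS_mul`), and all the series for the kernel are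
rearrangements of the resulting family. The substitution `s = R / η` in polar coordinates
(`integral_groundSet`) gives both these integrals and the dimensionless kernel. The real form
follows by adding the terms of orders `m` and `-m` (`sum_coefU_eq`). The kernel is not symmetric because its
integrand is proportional to `z_y`: it vanishes for `y = 0` and has a constant sign for `z_y > 0`.
-/

namespace GroundPlane

/-! ### Binomial series -/

lemma _root_.HasSum.of_eq {ι α : Type*} [AddCommMonoid α] [TopologicalSpace α] {f g : ι → α}
    {a b : α} (h : HasSum f a) (hf : ∀ i, g i = f i) (ha : b = a) : HasSum g b := by
  rwa [ha, funext hf]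

/-- Coefficient of `x ^ n` in the binomial series of `(1 - x) ^ (-s)`. -/
noncomputable def binCoef (s : ℝ) (n : ℕ) : ℝ := (∏ i ∈ Finset.range n, (s + i)) / (n.factorial : ℝ)

lemma binCoef_zero (s : ℝ) : binCoef s 0 = 1 := by simp [binCoef]

lemma binCoef_succ (s : ℝ) (n : ℕ) : binCoef s (n + 1) = binCoef s n * (s + n) / (n + 1) := by
  have : (n.factorial : ℝ) ≠ 0 := by positivity
  simp only [binCoef, Finset.prod_range_succ, Nat.factorial_succ]
  push_cast
  field_simp

lemma binCoef_nonneg {s : ℝ} (hs : 0 ≤ s) (n : ℕ) : 0 ≤ binCoef s n :=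
  div_nonneg (Finset.prod_nonneg fun i _ => by positivity) (by positivity)

/-- The linear bound is crude, but holds for both exponents `1 / 2` and `3 / 2` that are used. -/
lemma binCoef_le {s : ℝ} (hs : 0 ≤ s) (hs2 : s ≤ 2) (n : ℕ) : binCoef s n ≤ n + 1 := by
  induction n with
  | zero => simp [binCoef_zero]
  | succ n ih =>
    rw [binCoef_succ, div_le_iff₀ (by positivity)]
    push_cast
    have h0 := binCoef_nonneg hs n
    have : binCoef s n * (s + n) ≤ (n + 1) * (2 + n) := by gcongr
    nlinarith

lemma binCoef_eq_choose (s : ℝ) (n : ℕ) : binCoef s n = Ring.choose (s + n - 1) n := by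
  rw [Ring.choose, binCoef, div_eq_iff (by positivity), mul_comm, ← nsmul_eq_mul,
    show s + n - 1 - n + 1 = s by ring, Ring.factorial_nsmul_multichoose_eq_ascPochhammer,
    Polynomial.ascPochhammer_smeval_eq_eval]
  induction n with
  | zero => simp
  | succ n ih => rw [Finset.prod_range_succ, ascPochhammer_succ_eval, ih]

lemma hasSum_binCoef (s : ℝ) {x : ℂ} (hx : ‖x‖ < 1) :
    HasSum (fun n => (binCoef s n : ℂ) * x ^ n) ((1 - x) ^ (-(s : ℂ))) := by
  have h := (Complex.one_div_one_sub_cpow_hasFPowerSeriesOnBall_zero (s : ℂ)).hasSum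
    (y := x) (by simpa [← ofReal_norm, ENNReal.ofReal_lt_one] using hx)
  simp only [zero_add] at h
  refine h.of_eq (fun n => ?_) (by rw [Complex.cpow_neg, one_div])
  rw [binCoef_eq_choose, Complex.ofReal_choose]
  simp [mul_comm]

lemma hasSum_binCoef_real (s : ℝ) {x : ℝ} (hx : |x| < 1) :
    HasSum (fun n => binCoef s n * x ^ n) ((1 - x) ^ (-s)) := by
  have h := hasSum_binCoef s (x := (x : ℂ)) (by simpa using hx)
  rw [← Complex.hasSum_ofReal]
  convert h using 1
  · ext n; push_cast; rfl
  · rw [Complex.ofReal_cpow (by linarith [(abs_lt.1 hx).2])]; push_cast; rfl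

lemma summable_binCoef {s : ℝ} (hs : 0 ≤ s) {x : ℂ} (hx : ‖x‖ < 1) :
    Summable (fun n => ‖(binCoef s n : ℂ) * x ^ n‖) := by
  convert (hasSum_binCoef_real s (x := ‖x‖) (by simpa using hx)).summable using 2 with n
  rw [norm_mul, norm_pow, Complex.norm_real, Real.norm_of_nonneg (binCoef_nonneg hs n)]

lemma cpow_mul_cpow_conj (s : ℝ) {w : ℂ} (hw : 0 < w.re) :
    w ^ (-(s : ℂ)) * (starRingEnd ℂ w) ^ (-(s : ℂ)) = ((Complex.normSq w ^ (-s) : ℝ) : ℂ) := by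
  have harg : w.arg ≠ Real.pi := by
    intro h
    have := (Complex.arg_eq_pi_iff.1 h).1
    linarith
  have hn : 0 ≤ ‖w‖ := norm_nonneg _
  rw [← Complex.ofReal_neg, Complex.conj_cpow _ _ harg,
    Complex.conj_ofReal, Complex.mul_conj, Complex.normSq_eq_norm_sq, Complex.norm_cpow_real,
    Complex.normSq_eq_norm_sq, ← Real.rpow_natCast, ← Real.rpow_natCast, ← Real.rpow_mul hn,
    ← Real.rpow_mul hn, mul_comm]

/-- Terms of the expansion of `(1 - W) ^ (-s) * (1 - W') ^ (-s)` in powers of `W` and `W'`. -/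
noncomputable def pairTerm (s : ℝ) (W W' : ℂ) (q : ℕ × ℕ) : ℂ :=
  (binCoef s q.1 * binCoef s q.2 : ℝ) * (W ^ q.1 * W' ^ q.2)

lemma pairTerm_eq (s : ℝ) (W W' : ℂ) (q : ℕ × ℕ) : pairTerm s W W' q =
    ((binCoef s q.1 : ℂ) * W ^ q.1) * ((binCoef s q.2 : ℂ) * W' ^ q.2) := by
  simp only [pairTerm]; push_cast; ring

lemma summable_norm_pairTerm {s : ℝ} (hs : 0 ≤ s) {W W' : ℂ} (hW : ‖W‖ < 1) (hW' : ‖W'‖ < 1) :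
    Summable (fun q => ‖pairTerm s W W' q‖) := by
  simp only [pairTerm_eq]
  exact summable_mul_of_summable_norm' (summable_binCoef hs hW)
    (hasSum_binCoef s hW).summable (summable_binCoef hs hW')
    (hasSum_binCoef s hW').summable |>.norm

/-- This keeps `1 - W` off the branch cut of the complex power. -/
lemma one_sub_re_pos {W : ℂ} (hW : ‖W‖ < 1) : 0 < (1 - W).re := by
  have := Complex.re_le_norm W
  simp; linarith

lemma hasSum_pairTerm {s : ℝ} (hs : 0 ≤ s) {W : ℂ} (hW : ‖W‖ < 1) :
    HasSum (pairTerm s W (starRingEnd ℂ W)) ((Complex.normSq (1 - W) ^ (-s) : ℝ) : ℂ) := by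
  have hW' : ‖starRingEnd ℂ W‖ < 1 := by simpa using hW
  rw [← cpow_mul_cpow_conj s (one_sub_re_pos hW), map_sub, map_one]
  have h := (hasSum_binCoef s hW).mul (hasSum_binCoef s hW')
    ((summable_norm_pairTerm hs hW hW').of_norm.congr
    (pairTerm_eq s W _))
  exact h.of_eq (pairTerm_eq s W _) rfl

/-- Regrouping of a series according to the values of a degree function with finite fibres. -/
lemma _root_.HasSum.sum_fiber {ι α : Type*} [AddCommMonoid α] [TopologicalSpace α] [ContinuousAdd α]
    [RegularSpace α] {f : ι → α} {a : α} (h : HasSum f a) (d : ι → ℕ) (T : ℕ → Finset ι)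
    (hT : ∀ n q, q ∈ T n ↔ d q = n) : HasSum (fun n => ∑ q ∈ T n, f q) a := by
  refine ((Equiv.sigmaFiberEquiv d).hasSum_iff.2 h).sigma fun n => ?_
  have h1 := (T n).hasSum f
  rw [← (Equiv.subtypeEquivRight (hT n)).hasSum_iff]
  exact h1

/-- Homogeneous Gegenbauer polynomials: the coefficient of `t ^ n` in
`|1 - t μ| ^ (-2 s)`. -/
noncomputable def gegen (s : ℝ) (μ : ℂ) (n : ℕ) : ℂ :=
  ∑ q ∈ Finset.HasAntidiagonal.antidiagonal n, pairTerm s μ (starRingEnd ℂ μ) q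

lemma pairTerm_smul (s : ℝ) (t : ℂ) (W W' : ℂ) (q : ℕ × ℕ) :
    pairTerm s (t * W) (t * W') q = t ^ (q.1 + q.2) * pairTerm s W W' q := by
  simp only [pairTerm, mul_pow, pow_add]; ring

lemma hasSum_gegen {s : ℝ} (hs : 0 ≤ s) {μ : ℂ} {t : ℝ} (ht : |t| * ‖μ‖ < 1) :
    HasSum (fun n => (t : ℂ) ^ n * gegen s μ n)
      ((Complex.normSq (1 - t * μ) ^ (-s) : ℝ) : ℂ) := by
  have h := (hasSum_pairTerm hs (W := t * μ) (by simpa using ht)).sum_fiber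
    (fun q => q.1 + q.2) Finset.HasAntidiagonal.antidiagonal
    (fun n q => Finset.HasAntidiagonal.mem_antidiagonal)
  refine h.of_eq (fun n => ?_) rfl
  rw [gegen, Finset.mul_sum]
  refine Finset.sum_congr rfl fun q hq => ?_
  rw [map_mul, Complex.conj_ofReal, pairTerm_smul, Finset.HasAntidiagonal.mem_antidiagonal.1 hq]

lemma norm_gegen_le {s : ℝ} (hs : 0 ≤ s) (hs2 : s ≤ 2) (μ : ℂ) (n : ℕ) :
    ‖gegen s μ n‖ ≤ (n + 1) ^ 3 * ‖μ‖ ^ n := by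
  refine (norm_sum_le_of_le _ (f := fun q : ℕ × ℕ => pairTerm s μ (starRingEnd ℂ μ) q)
    (n := fun _ : ℕ × ℕ => ((n : ℝ) + 1) ^ 2 * ‖μ‖ ^ n) fun q hq => ?_).trans ?_
  · have hq := Finset.HasAntidiagonal.mem_antidiagonal.1 hq
    have h1 : (q.1 : ℝ) ≤ n := by exact_mod_cast (by omega : q.1 ≤ n)
    have h2 : (q.2 : ℝ) ≤ n := by exact_mod_cast (by omega : q.2 ≤ n)
    rw [pairTerm, norm_mul, norm_mul, norm_pow, norm_pow, Complex.norm_conj, ← pow_add, hq,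
      Complex.norm_real, norm_mul, Real.norm_of_nonneg (binCoef_nonneg hs _),
      Real.norm_of_nonneg (binCoef_nonneg hs _), sq]
    gcongr
    · exact binCoef_nonneg hs _
    · exact (binCoef_le hs hs2 _).trans (by linarith)
    · exact (binCoef_le hs hs2 _).trans (by linarith)
  · rw [Finset.sum_const, Finset.Nat.card_antidiagonal, nsmul_eq_mul]
    push_cast
    apply le_of_eq; ring

/-- Terms of the expansion of `(|1 - W| ^ 2 + z ^ 2) ^ (-s)` in powers of `z`, `W`, `conj W`. -/
noncomputable def tripleTerm (s z : ℝ) (W W' : ℂ) (q : ℕ × ℕ × ℕ) : ℂ :=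
  ((-1) ^ q.1 * binCoef s q.1 * z ^ (2 * q.1) : ℝ) * pairTerm (s + q.1) W W' q.2

lemma tsum_norm_pairTerm {s : ℝ} (hs : 0 ≤ s) {W : ℂ} (hW : ‖W‖ < 1) :
    ∑' q, ‖pairTerm s W (starRingEnd ℂ W) q‖ = ((1 - ‖W‖) ^ 2) ^ (-s) := by
  have h := hasSum_pairTerm hs (W := (‖W‖ : ℂ)) (by simpa using hW)
  rw [← Complex.ofReal_inj,
    ← Complex.hasSum_ofReal.2 (summable_norm_pairTerm hs hW (by simpa using hW)).hasSum |>.tsum_eq]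
  rw [show ((1 - ‖W‖) ^ 2) = Complex.normSq (1 - (‖W‖ : ℂ)) by
    rw [← Complex.ofReal_one, ← Complex.ofReal_sub, Complex.normSq_ofReal]; ring, ← h.tsum_eq]
  refine tsum_congr fun q => ?_
  rw [pairTerm, norm_mul, norm_mul, norm_pow, norm_pow, Complex.norm_conj, Complex.norm_real,
    Real.norm_of_nonneg (mul_nonneg (binCoef_nonneg hs _) (binCoef_nonneg hs _)), pairTerm,
    Complex.conj_ofReal]
  push_cast; rfl

/-- The condition `|z| < 1 - ‖W‖` makes the series of absolute values converge: summed over the two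
horizontal exponents it is a binomial series in `z ^ 2 / (1 - ‖W‖) ^ 2`. -/
lemma hasSum_tripleTerm {s : ℝ} (hs : 0 ≤ s) {z : ℝ} {W : ℂ} (h : |z| < 1 - ‖W‖) :
    HasSum (tripleTerm s z W (starRingEnd ℂ W))
      (((Complex.normSq (1 - W) + z ^ 2) ^ (-s) : ℝ) : ℂ) := by
  have hW : ‖W‖ < 1 := by linarith [abs_nonneg z]
  have hW' : ‖starRingEnd ℂ W‖ < 1 := by simpa using hW
  have hsj : ∀ j : ℕ, 0 ≤ s + j := fun j => by positivity
  set D := Complex.normSq (1 - W) with hD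
  have hD1 : (1 - ‖W‖) ^ 2 ≤ D := by
    rw [hD, Complex.normSq_eq_norm_sq]
    have := norm_sub_norm_le (1 : ℂ) W
    rw [norm_one] at this
    gcongr
  have hp : 0 < (1 - ‖W‖) ^ 2 := by
    have : 0 < 1 - ‖W‖ := by linarith
    positivity
  have hz2 : z ^ 2 < (1 - ‖W‖) ^ 2 := by
    rw [← sq_abs z]; exact pow_lt_pow_left₀ h (abs_nonneg _) two_ne_zero
  have hDp : 0 < D := hp.trans_le hD1
  have hpow : ∀ (X : ℝ), 0 < X → ∀ j : ℕ, binCoef s j * z ^ (2 * j) * X ^ (-(s + j)) =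
      X ^ (-s) * (binCoef s j * (z ^ 2 / X) ^ j) := fun X hX j => by
    rw [neg_add, Real.rpow_add hX, Real.rpow_neg hX.le (j : ℝ), Real.rpow_natCast, div_pow, pow_mul]
    ring
  -- absolute convergence: sum first over the pairs, then over the exponent of `z ^ 2`
  have hsum : Summable (tripleTerm s z W (starRingEnd ℂ W)) := by
    refine Summable.of_norm ((summable_prod_of_nonneg fun _ => norm_nonneg _).2 ⟨fun j => ?_, ?_⟩)
    · simp only [tripleTerm, norm_mul]
      exact (summable_norm_pairTerm (hsj j) hW hW').mul_left _
    · have : ∀ j, ∑' p, ‖tripleTerm s z W (starRingEnd ℂ W) (j, p)‖ =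
          ((1 - ‖W‖) ^ 2) ^ (-s) * (binCoef s j * (z ^ 2 / (1 - ‖W‖) ^ 2) ^ j) := fun j => by
        rw [← hpow _ hp, ← tsum_norm_pairTerm (hsj j) hW, ← tsum_mul_left]
        refine tsum_congr fun p => ?_
        rw [tripleTerm, norm_mul, Complex.norm_real, norm_mul, norm_mul,
          Real.norm_of_nonneg (binCoef_nonneg hs j)]
        simp [pow_mul]
      simp only [this]
      refine Summable.mul_left _ (hasSum_binCoef_real s ?_).summable
      rw [abs_of_nonneg (by positivity), div_lt_one hp]
      exact hz2
  have h1 : ∀ j, HasSum (fun p => tripleTerm s z W (starRingEnd ℂ W) (j, p))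
      ((D ^ (-s) * (binCoef s j * (-(z ^ 2 / D)) ^ j) : ℝ) : ℂ) := fun j => by
    have := (hasSum_pairTerm (hsj j) hW).mul_left
      (((-1) ^ j * binCoef s j * z ^ (2 * j) : ℝ) : ℂ)
    refine this.of_eq (fun _ => rfl) ?_
    rw [← Complex.ofReal_mul, neg_pow]
    congr 1
    linear_combination (-(-1) ^ j) * hpow D hDp j
  have h2 := hsum.hasSum.prod_fiberwise h1
  have h3 : HasSum (fun j => ((D ^ (-s) * (binCoef s j * (-(z ^ 2 / D)) ^ j) : ℝ) : ℂ))
      (((D + z ^ 2) ^ (-s) : ℝ) : ℂ) := by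
    rw [Complex.hasSum_ofReal]
    have h4 := (hasSum_binCoef_real s (x := -(z ^ 2 / D)) (by
      rw [abs_neg, abs_of_nonneg (by positivity), div_lt_one hDp]; linarith)).mul_left (D ^ (-s))
    refine h4.of_eq (fun _ => rfl) ?_
    rw [sub_neg_eq_add, ← Real.mul_rpow hDp.le (by positivity)]
    congr 1
    field_simp
  exact h2.unique h3 ▸ hsum.hasSum

/-- Uniqueness of the coefficients of a convergent power series in a real variable. -/
lemma coeff_unique {p q : ℕ → ℂ} {f : ℝ → ℂ} {δ : ℝ} (hδ : 0 < δ)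
    (hp : ∀ t : ℝ, |t| < δ → HasSum (fun n => (t : ℂ) ^ n * p n) (f t))
    (hq : ∀ t : ℝ, |t| < δ → HasSum (fun n => (t : ℂ) ^ n * q n) (f t)) : p = q := by
  -- the power series with given coefficients as a formal multilinear series over `ℝ`
  let P : (ℕ → ℂ) → FormalMultilinearSeries ℝ ℝ ℂ := fun r n =>
    ContinuousMultilinearMap.mkPiRing ℝ (Fin n) (r n)
  have key : ∀ r : ℕ → ℂ, (∀ t : ℝ, |t| < δ → HasSum (fun n => (t : ℂ) ^ n * r n) (f t)) →
      HasFPowerSeriesAt f (P r) 0 := by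
    intro r hr
    rw [hasFPowerSeriesAt_iff]
    filter_upwards [Metric.ball_mem_nhds (0 : ℝ) hδ] with t ht
    rw [zero_add]
    refine (hr t (by simpa using ht)).of_eq (fun n => ?_) rfl
    simp [FormalMultilinearSeries.coeff, P]
  have h := (key p hp).eq_formalMultilinearSeries (key q hq)
  funext n
  have := congrArg (fun P : FormalMultilinearSeries ℝ ℝ ℂ => P.coeff n) h
  simpa [FormalMultilinearSeries.coeff, P] using this

/-! ### Associated Legendre functions -/

/-- Exponents `(c, a, b)` of the monomials of degree `n` in three variables. -/
def triples (n : ℕ) : Finset (ℕ × ℕ × ℕ) :=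
  (Finset.range (n + 1) ×ˢ Finset.range (n + 1) ×ˢ Finset.range (n + 1)).filter
    fun q => q.1 + q.2.1 + q.2.2 = n

lemma mem_triples {n : ℕ} {q : ℕ × ℕ × ℕ} : q ∈ triples n ↔ q.1 + q.2.1 + q.2.2 = n := by
  simp only [triples, Finset.mem_filter, Finset.mem_product, Finset.mem_range]
  omega

lemma sum_triples {α : Type*} [AddCommMonoid α] (n : ℕ) (f : ℕ × ℕ × ℕ → α) :
    ∑ q ∈ triples n, f q = ∑ p ∈ Finset.HasAntidiagonal.antidiagonal n,
      ∑ r ∈ Finset.HasAntidiagonal.antidiagonal p.2, f (p.1, r) := by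
  rw [Finset.sum_sigma']
  refine Finset.sum_nbij' (fun q => ⟨(q.1, q.2.1 + q.2.2), q.2⟩) (fun s => (s.1.1, s.2))
    ?_ ?_ ?_ ?_ ?_
  · intro q hq
    have := mem_triples.1 hq
    simp; omega
  · rintro ⟨⟨c, N⟩, ⟨a, b⟩⟩ h
    simp at h
    rw [mem_triples]; simp; omega
  · intro q _; rfl
  · rintro ⟨⟨c, N⟩, ⟨a, b⟩⟩ h
    simp at h
    simp [h.2]
  · intro q _; rfl

/-- The derivatives of `(ξ ^ 2 - 1) ^ n` are Taylor coefficients of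
`((ξ + h) ^ 2 - 1) ^ n = (2 ξ h + h ^ 2 + (ξ ^ 2 - 1)) ^ n`, given by the trinomial theorem. -/
lemma eval_iterate_derivative (n k : ℕ) (ξ : ℝ) :
    (Polynomial.derivative^[n + k] ((Polynomial.X ^ 2 - 1) ^ n : Polynomial ℝ)).eval ξ =
      ((n + k).factorial : ℝ) * n.factorial * ∑ q ∈ (triples n).filter (fun q => q.2.1 = q.2.2 + k),
        (2 * ξ) ^ q.1 * (ξ ^ 2 - 1) ^ q.2.2 /
          (q.1.factorial * q.2.1.factorial * q.2.2.factorial) := by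
  have h1 := congrFun (Polynomial.factorial_smul_hasseDeriv (R := ℝ) (n + k))
    ((Polynomial.X ^ 2 - 1) ^ n : Polynomial ℝ)
  simp only [LinearMap.smul_apply] at h1
  rw [← h1, Polynomial.eval_smul, ← Polynomial.taylor_coeff, Polynomial.taylor_pow, map_sub,
    Polynomial.taylor_X_pow, Polynomial.taylor_one, nsmul_eq_mul, mul_assoc]
  congr 1
  have h2 : ((Polynomial.X + Polynomial.C ξ) ^ 2 - Polynomial.C 1 : Polynomial ℝ) =
      Polynomial.C (2 * ξ) * Polynomial.X +
        (Polynomial.X ^ 2 + Polynomial.C (ξ ^ 2 - 1)) := by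
    simp only [map_mul, map_sub, map_pow, map_ofNat]; ring
  rw [h2, (Commute.all _ _).add_pow']
  simp only [(Commute.all (Polynomial.X ^ 2 : Polynomial ℝ) _).add_pow', Finset.mul_sum,
    Finset.smul_sum, Polynomial.finsetSum_coeff, Finset.sum_filter]
  rw [sum_triples]
  refine Finset.sum_congr rfl fun p hp => Finset.sum_congr rfl fun r hr => ?_
  have hp := Finset.HasAntidiagonal.mem_antidiagonal.1 hp
  have hr := Finset.HasAntidiagonal.mem_antidiagonal.1 hr
  have e : (n.choose p.1 • ((Polynomial.C (2 * ξ) * Polynomial.X) ^ p.1 *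
      p.2.choose r.1 • ((Polynomial.X ^ 2) ^ r.1 * Polynomial.C (ξ ^ 2 - 1) ^ r.2)) : Polynomial ℝ)
      = Polynomial.C ((n.choose p.1 : ℝ) * p.2.choose r.1 * (2 * ξ) ^ p.1 * (ξ ^ 2 - 1) ^ r.2) *
        Polynomial.X ^ (p.1 + 2 * r.1) := by
    simp only [nsmul_eq_mul, map_mul, map_pow, mul_pow, pow_add, pow_mul, map_natCast]
    ring
  rw [e, Polynomial.coeff_C_mul_X_pow]
  have hc : (n.choose p.1 : ℝ) * p.2.choose r.1 =
      n.factorial / (p.1.factorial * r.1.factorial * r.2.factorial) := by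
    have hc1 := Nat.add_choose_mul_factorial_mul_factorial p.2 p.1
    have hc2 := Nat.add_choose_mul_factorial_mul_factorial r.2 r.1
    rw [add_comm, hp] at hc1
    rw [add_comm, hr] at hc2
    rw [eq_div_iff (by positivity), ← hc1]
    push_cast
    rw [← hc2]
    push_cast
    ring
  rw [hc]
  dsimp only
  split_ifs with h3 h4 h4
  · ring
  · omega
  · omega
  · simp

/-- Every term has `a - b = k`, where `a`, `b` are the exponents of `h ^ 2` and `ξ ^ 2 - 1`, so the
prefactor of order `k` can be absorbed in the sum. -/
lemma legendreP_eq (n k : ℕ) (ξ : ℝ) :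
    legendreP n k ξ = (-1) ^ k * (n + k).factorial / 2 ^ n *
      ∑ q ∈ (triples n).filter (fun q => q.2.1 = q.2.2 + k),
        Real.sqrt (1 - ξ ^ 2) ^ k * ((2 * ξ) ^ q.1 * (ξ ^ 2 - 1) ^ q.2.2 /
          (q.1.factorial * q.2.1.factorial * q.2.2.factorial)) := by
  rw [legendreP, eval_iterate_derivative, ← Finset.mul_sum]
  have : (n.factorial : ℝ) ≠ 0 := by positivity
  field_simp

lemma legendreP_of_lt {n k : ℕ} (h : n < k) (ξ : ℝ) : legendreP n k ξ = 0 := by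
  rw [legendreP_eq, Finset.sum_eq_zero, mul_zero]
  intro q hq
  rw [Finset.mem_filter, mem_triples] at hq
  omega

/-- At `ξ = 0` only the term without a factor `ξ` survives. -/
lemma legendreP_zero {n k : ℕ} (h : k ≤ n) : legendreP n k 0 = parityL n k *
    ((-1) ^ ((n + k) / 2) * ((n + k).factorial : ℝ) /
        (2 ^ n * (((n - k) / 2).factorial : ℝ) * (((n + k) / 2).factorial : ℝ))) := by
  rw [legendreP_eq, parityL]
  split_ifs with he
  · have he' : Even (n + k) := by exact_mod_cast he
    obtain ⟨r, hr⟩ := he'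
    rw [Finset.sum_eq_single (0, (n + k) / 2, (n - k) / 2)]
    · have h1 : (n + k) / 2 = (n - k) / 2 + k := by omega
      have : ((-1 : ℝ)) ^ ((n + k) / 2) = (-1) ^ k * (-1) ^ ((n - k) / 2) := by
        rw [h1, pow_add, mul_comm]
      rw [this]
      simp
      field_simp
    · rintro ⟨c, a, b⟩ hq hne
      rw [Finset.mem_filter, mem_triples] at hq
      simp only at hq
      have hc : c ≠ 0 := by
        rintro rfl
        apply hne
        ext
        · rfl
        · simp; omega
        · simp; omega
      simp [hc]
    · intro hn
      exfalso
      apply hn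
      rw [Finset.mem_filter, mem_triples]
      simp only
      omega
  · rw [Finset.sum_eq_zero]
    · simp
    · rintro ⟨c, a, b⟩ hq
      rw [Finset.mem_filter, mem_triples] at hq
      simp only at hq
      have hc : c ≠ 0 := by
        rintro rfl
        apply he
        refine ⟨a, ?_⟩
        omega
      simp [hc]

/-! ### Solid harmonics and their coefficients -/

/-- The projection of a point to the horizontal plane, as a complex number. -/
def horiz (v : E3) : ℂ := ⟨v 0, v 1⟩

/-- The radial and polar part `r ^ n P_n^k(cos θ) / (n + k)!` of a solid harmonic. -/
noncomputable def solidPolar (n k : ℕ) (v : E3) : ℝ :=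
  ‖v‖ ^ n * legendreP n k (Real.cos (polarAngle v)) / (n + k).factorial

/-- The regular solid harmonic `r ^ n P_n^|m|(cos θ) e^(i m φ) / (n + |m|)!`. -/
noncomputable def solidH (n : ℕ) (m : ℤ) (v : E3) : ℂ :=
  solidPolar n m.natAbs v * Complex.exp (Complex.I * m * azimuth v)

lemma norm_sq_E3 (v : E3) : ‖v‖ ^ 2 = v 0 ^ 2 + v 1 ^ 2 + v 2 ^ 2 := by
  rw [EuclideanSpace.norm_sq_eq, Fin.sum_univ_three]; simp

lemma rho_eq_norm (v : E3) : rho v = ‖horiz v‖ := by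
  rw [rho, Complex.norm_eq_sqrt_sq_add_sq]; rfl

lemma horiz_eq (v : E3) : horiz v = rho v * Complex.exp (azimuth v * Complex.I) := by
  rw [rho_eq_norm, azimuth]
  exact (Complex.norm_mul_exp_arg_mul_I _).symm

lemma norm_horiz_sq (v : E3) : ‖horiz v‖ ^ 2 = v 0 ^ 2 + v 1 ^ 2 := by
  rw [← Complex.normSq_eq_norm_sq, Complex.normSq_apply]; simp [horiz]; ring

lemma cos_polarAngle (v : E3) : Real.cos (polarAngle v) = v 2 / ‖v‖ := by
  have h : |v 2| ≤ ‖v‖ := by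
    apply abs_le_of_sq_le_sq _ (norm_nonneg _)
    rw [norm_sq_E3]; nlinarith [sq_nonneg (v 0), sq_nonneg (v 1)]
  have h2 : |v 2 / ‖v‖| ≤ 1 := by
    rw [abs_div, abs_norm]; exact div_le_one_of_le₀ h (norm_nonneg _)
  rw [polarAngle, Real.cos_arccos (abs_le.1 h2).1 (abs_le.1 h2).2]

/-- Also true at the origin, where both sides are zero. -/
lemma norm_mul_cos (v : E3) : ‖v‖ * Real.cos (polarAngle v) = v 2 := by
  rw [cos_polarAngle]
  rcases eq_or_ne v 0 with rfl | h
  · simp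
  · field_simp [norm_ne_zero_iff.2 h]

lemma norm_mul_sqrt (v : E3) :
    ‖v‖ * Real.sqrt (1 - Real.cos (polarAngle v) ^ 2) = rho v := by
  rw [rho_eq_norm, ← sq_eq_sq₀ (by positivity) (norm_nonneg _), mul_pow,
    Real.sq_sqrt (by
      nlinarith [Real.sin_sq_add_cos_sq (polarAngle v), sq_nonneg (Real.sin (polarAngle v))]),
    norm_horiz_sq]
  have := norm_mul_cos v
  have h2 := norm_sq_E3 v
  rw [← this] at h2
  linarith

lemma solidPolar_eq (n k : ℕ) (v : E3) : solidPolar n k v = (-1) ^ k / 2 ^ n *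
    ∑ q ∈ (triples n).filter (fun q => q.2.1 = q.2.2 + k),
      (-1) ^ q.2.2 * rho v ^ (q.2.1 + q.2.2) * (2 * v 2) ^ q.1 /
        (q.1.factorial * q.2.1.factorial * q.2.2.factorial) := by
  rw [solidPolar, legendreP_eq, Finset.mul_sum, Finset.mul_sum, Finset.mul_sum, Finset.sum_div]
  refine Finset.sum_congr rfl fun q hq => ?_
  rw [Finset.mem_filter, mem_triples] at hq
  set ξ := Real.cos (polarAngle v) with hξ
  have hs : ξ ^ 2 - 1 = - Real.sqrt (1 - ξ ^ 2) ^ 2 := by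
    rw [Real.sq_sqrt (by
      nlinarith [Real.sin_sq_add_cos_sq (polarAngle v), sq_nonneg (Real.sin (polarAngle v))])]
    ring
  have h1 : ‖v‖ ^ n = ‖v‖ ^ q.1 * ‖v‖ ^ (q.2.1 + q.2.2) := by rw [← pow_add]; congr 1; omega
  have h2 : Real.sqrt (1 - ξ ^ 2) ^ (q.2.1 + q.2.2) =
    Real.sqrt (1 - ξ ^ 2) ^ k * (Real.sqrt (1 - ξ ^ 2) ^ 2) ^ q.2.2 := by
    rw [← pow_mul, ← pow_add]; congr 1; omega
  rw [← norm_mul_cos v, ← norm_mul_sqrt v, ← hξ, hs, neg_pow, h1, mul_pow _ _ (q.2.1 + q.2.2), h2]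
  have : ((n + k).factorial : ℝ) ≠ 0 := by positivity
  field_simp
  ring

/-- The monomial of exponents `q = (c, a, b)` in the polynomial form of `solidH`, as a function of
`z`, `w` and `w' = conj w`. -/
noncomputable def solidTerm (z : ℝ) (w w' : ℂ) (q : ℕ × ℕ × ℕ) : ℂ :=
  (-1) ^ (min q.2.1 q.2.2) * w ^ q.2.1 * w' ^ q.2.2 * (2 * z) ^ q.1 /
    (q.1.factorial * q.2.1.factorial * q.2.2.factorial)

lemma conj_exp_I (φ : ℝ) : starRingEnd ℂ (Complex.exp (φ * Complex.I)) =
    Complex.exp (-(φ * Complex.I)) := by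
  rw [← Complex.exp_conj]; simp

lemma solidTerm_polar (v : E3) (q : ℕ × ℕ × ℕ) :
    solidTerm (v 2) (horiz v) (starRingEnd ℂ (horiz v)) q =
      ((-1) ^ (min q.2.1 q.2.2) * rho v ^ (q.2.1 + q.2.2) * (2 * v 2) ^ q.1 /
        (q.1.factorial * q.2.1.factorial * q.2.2.factorial) : ℝ) *
        Complex.exp (Complex.I * ((q.2.1 - q.2.2 : ℤ) : ℂ) * azimuth v) := by
  rw [solidTerm, horiz_eq, map_mul, Complex.conj_ofReal, conj_exp_I, mul_pow, mul_pow,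
    ← Complex.exp_nat_mul, ← Complex.exp_nat_mul]
  have : Complex.exp (Complex.I * ((q.2.1 - q.2.2 : ℤ) : ℂ) * azimuth v) =
    Complex.exp (q.2.1 * (azimuth v * Complex.I)) *
      Complex.exp (q.2.2 * -(azimuth v * Complex.I)) := by
    rw [← Complex.exp_add]; congr 1; push_cast; ring
  rw [this]
  push_cast
  rw [pow_add]
  ring

/-- The solid harmonic of degree `n` and order `m` as a polynomial: it consists of the monomials
`w ^ a * (conj w) ^ b * z ^ c` of degree `n` with `a - b = m`. -/
lemma solidH_eq (n : ℕ) (m : ℤ) (v : E3) : solidH n m v = (-1) ^ m.natAbs / 2 ^ n *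
    ∑ q ∈ (triples n).filter (fun q => (q.2.1 : ℤ) - q.2.2 = m),
      solidTerm (v 2) (horiz v) (starRingEnd ℂ (horiz v)) q := by
  have h1 : ∑ q ∈ (triples n).filter (fun q => (q.2.1 : ℤ) - q.2.2 = m),
      solidTerm (v 2) (horiz v) (starRingEnd ℂ (horiz v)) q =
      (∑ q ∈ (triples n).filter (fun q => (q.2.1 : ℤ) - q.2.2 = m),
        ((-1) ^ (min q.2.1 q.2.2) * rho v ^ (q.2.1 + q.2.2) * (2 * v 2) ^ q.1 /
        (q.1.factorial * q.2.1.factorial * q.2.2.factorial) : ℝ) : ℝ) *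
        Complex.exp (Complex.I * m * azimuth v) := by
    rw [Complex.ofReal_sum, Finset.sum_mul]
    refine Finset.sum_congr rfl fun q hq => ?_
    rw [Finset.mem_filter] at hq
    rw [solidTerm_polar, hq.2]
  have h2 : ∑ q ∈ (triples n).filter (fun q => q.2.1 = q.2.2 + m.natAbs),
      (-1) ^ q.2.2 * rho v ^ (q.2.1 + q.2.2) * (2 * v 2) ^ q.1 /
        (q.1.factorial * q.2.1.factorial * q.2.2.factorial) =
      ∑ q ∈ (triples n).filter (fun q => (q.2.1 : ℤ) - q.2.2 = m),
        (-1) ^ (min q.2.1 q.2.2) * rho v ^ (q.2.1 + q.2.2) * (2 * v 2) ^ q.1 /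
        (q.1.factorial * q.2.1.factorial * q.2.2.factorial) := by
    rcases le_total 0 m with hm | hm
    · refine Finset.sum_congr ?_ fun q hq => ?_
      · ext q
        simp only [Finset.mem_filter]
        exact and_congr_right fun _ => by omega
      · rw [Finset.mem_filter] at hq
        rw [min_eq_right (by omega)]
    · -- negative orders: exchange the two horizontal exponents
      refine Finset.sum_nbij' (fun q => (q.1, q.2.2, q.2.1)) (fun q => (q.1, q.2.2, q.2.1))
        ?_ ?_ (fun _ _ => rfl) (fun _ _ => rfl) ?_
      · intro q hq
        simp only [Finset.mem_filter, mem_triples] at hq ⊢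
        omega
      · intro q hq
        simp only [Finset.mem_filter, mem_triples] at hq ⊢
        omega
      · intro q hq
        rw [Finset.mem_filter] at hq
        dsimp only
        rw [min_eq_left (by omega), add_comm q.2.1]
        ring
  rw [h1, solidH, solidPolar_eq, h2]
  push_cast
  ring

lemma solidH_of_lt {n : ℕ} {m : ℤ} (h : n < m.natAbs) (v : E3) : solidH n m v = 0 := by
  simp [solidH, solidPolar, legendreP_of_lt h]

lemma regR_eq (n : ℕ) (m : ℤ) (v : E3) :
    regR n m v = (normConst n m * (n + m.natAbs).factorial : ℝ) * solidH n m v := by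
  have : ((n + m.natAbs).factorial : ℂ) ≠ 0 := by exact_mod_cast Nat.factorial_ne_zero _
  rw [regR, sphY, solidH, solidPolar]
  push_cast
  field_simp

lemma regR_of_lt {n : ℕ} {m : ℤ} (h : n < m.natAbs) (v : E3) : regR n m v = 0 := by
  rw [regR_eq, solidH_of_lt h, mul_zero]

lemma parityL_neg (n : ℕ) (m : ℤ) : parityL n (-m) = parityL n m := by
  have : Even ((n : ℤ) + -m) ↔ Even ((n : ℤ) + m) := by
    rw [Int.even_add, Int.even_add, even_neg]
  simp [parityL, this]

lemma parityL_natAbs (n : ℕ) (m : ℤ) : parityL n (m.natAbs : ℤ) = parityL n m := by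
  rcases Int.natAbs_eq m with h | h
  · rw [← h]
  · conv_rhs => rw [h, parityL_neg]

lemma normConst_neg (n : ℕ) (m : ℤ) : normConst n (-m) = normConst n m := by simp [normConst]
lemma coefL_neg (n : ℕ) (m : ℤ) : coefL n (-m) = coefL n m := by simp [coefL, normConst_neg]
lemma coefNu_neg (n : ℕ) (m : ℤ) : coefNu n (-m) = coefNu n m := by simp [coefNu, parityL_neg]
lemma coefA_neg (n : ℕ) (m : ℤ) : coefA n (-m) = coefA n m := by
  simp only [coefA, Int.natAbs_neg]; push_cast; congr 2; ring
lemma coefJ_neg (m : ℤ) (n n' : ℕ) : coefJ (-m) n n' = coefJ m n n' := by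
  simp [coefJ, coefA_neg, coefL_neg]

lemma coefL_eq {n : ℕ} {m : ℤ} (h : m.natAbs ≤ n) : coefL n m = parityL n m *
    ((-1) ^ ((n + m.natAbs) / 2) * ((n + m.natAbs).factorial : ℝ) /
        (2 ^ n * (((n - m.natAbs) / 2).factorial : ℝ) * (((n + m.natAbs) / 2).factorial : ℝ))) *
        normConst n m := by
  rw [coefL, legendreP_zero h, parityL_natAbs, mul_comm]

lemma coefL_of_lt {n : ℕ} {m : ℤ} (h : n < m.natAbs) : coefL n m = 0 := by
  rw [coefL, legendreP_of_lt h, mul_zero]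

lemma coefL_mul_succ (n : ℕ) (m : ℤ) : coefL n m * coefL (n + 1) m = 0 := by
  rcases lt_or_ge n m.natAbs with h | h
  · rw [coefL_of_lt h, zero_mul]
  · rw [coefL_eq h, coefL_eq (h.trans n.le_succ)]
    by_cases he : Even ((n : ℤ) + m)
    · have : parityL (n + 1) m = 0 := by
        rw [parityL, if_neg]
        rw [Int.even_iff] at he ⊢
        push_cast
        omega
      rw [this]; ring
    · have : parityL n m = 0 := by rw [parityL, if_neg he]
      rw [this]; ring

/-- For `q = 0` the truncated subtraction gives `0‼ = 1`, the convention for `(-1)‼`. -/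
lemma doubleFactorial_odd (q : ℕ) :
    ((2 * q - 1).doubleFactorial : ℝ) = (2 * q).factorial / (2 ^ q * q.factorial) := by
  rw [eq_div_iff (by positivity)]
  cases q with
  | zero => simp
  | succ q =>
    have h := Nat.factorial_eq_mul_doubleFactorial (2 * q + 1)
    rw [show 2 * q + 1 + 1 = 2 * (q + 1) by ring, Nat.doubleFactorial_two_mul] at h
    rw [show 2 * (q + 1) - 1 = 2 * q + 1 by omega, h]
    push_cast; ring

lemma coefNu_eq {n : ℕ} {m : ℤ} (h : m.natAbs ≤ n) : coefNu n m = parityL n m *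
    ((-1) ^ ((n + m.natAbs) / 2) * ((n + m.natAbs).factorial : ℝ) /
        (2 ^ n * (((n - m.natAbs) / 2).factorial : ℝ) * (((n + m.natAbs) / 2).factorial : ℝ))) *
        (n - m.natAbs).factorial := by
  rw [coefNu, parityL]
  split_ifs with he
  · rw [Int.even_iff] at he
    set k := m.natAbs with hk
    obtain ⟨r, hr⟩ : ∃ r, n - k = 2 * r := ⟨(n - k) / 2, by omega⟩
    have h2 : n + k = 2 * (r + k) := by omega
    rw [hr, h2, doubleFactorial_odd, doubleFactorial_odd, show n = r + (r + k) by omega, pow_add]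
    simp only [Nat.mul_div_cancel_left _ (show 0 < 2 by norm_num)]
    field_simp
    ring
  · simp

lemma normConst_sq {n : ℕ} (m : ℤ) : normConst n m ^ 2 = (2 * n + 1) / (4 * Real.pi) *
    (((n - m.natAbs).factorial : ℝ) / ((n + m.natAbs).factorial : ℝ)) := by
  rw [normConst, mul_pow, Real.sq_sqrt (by positivity), ← pow_mul, mul_comm _ 2, pow_mul]
  simp

lemma coefL_mul_normConst {n : ℕ} {m : ℤ} (h : m.natAbs ≤ n) :
    4 * Real.pi / (2 * n + 1) * coefL n m * (normConst n m * (n + m.natAbs).factorial) =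
      coefNu n m := by
  have h1 := normConst_sq (n := n) m
  rw [coefL_eq h, coefNu_eq h]
  have : ((n + m.natAbs).factorial : ℝ) ≠ 0 := by positivity
  have h3 : 4 * Real.pi / (2 * n + 1) * (n + m.natAbs).factorial * normConst n m ^ 2 =
      (n - m.natAbs).factorial := by rw [h1]; field_simp
  rw [← h3]; ring

/-- The analogue of `coefL_mul_normConst` for the vertical derivative, which raises the
degree by one. -/
lemma coefA_mul_coefL {n : ℕ} {m : ℤ} (h : m.natAbs ≤ n) :
    4 * Real.pi * coefA n m * coefL (n + 1) m * (normConst n m * (n + m.natAbs).factorial) =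
      coefNu (n + 1) m := by
  rw [coefL_eq (h.trans n.le_succ), coefNu_eq (h.trans n.le_succ)]
  have h3 : 4 * Real.pi * coefA n m * normConst (n + 1) m * normConst n m *
      (n + m.natAbs).factorial = (n + 1 - m.natAbs).factorial := by
    have hk : (m.natAbs : ℝ) ≤ n := by exact_mod_cast h
    have e : coefA n m = Real.sqrt (((n : ℝ) + 1 + m.natAbs) * ((n : ℝ) + 1 - m.natAbs) /
        ((2 * n + 1) * (2 * n + 3))) := by
      rw [coefA, if_pos h]
      have : ((m : ℝ)) ^ 2 = (m.natAbs : ℝ) ^ 2 := by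
        rw [Nat.cast_natAbs, Int.cast_abs, sq_abs]
      congr 2
      linear_combination -this
    rw [e, normConst, normConst, show n + 1 - m.natAbs = n - m.natAbs + 1 by omega,
      show n + 1 + m.natAbs = n + m.natAbs + 1 by omega, Nat.factorial_succ, Nat.factorial_succ]
    set k := m.natAbs
    have h4 : ((n - k : ℕ) : ℝ) = n - k := by push_cast [h]; ring
    push_cast
    rw [h4]
    have hA : (0 : ℝ) < (n - k).factorial := by positivity
    have hB : (0 : ℝ) < (n + k).factorial := by positivity
    set A : ℝ := ((n - k).factorial : ℝ)
    set B : ℝ := ((n + k).factorial : ℝ)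
    have hx : (0:ℝ) < n + 1 - k := by linarith
    have hy : (0:ℝ) < n + 1 + k := by positivity
    have h5 : Real.sqrt (((n : ℝ) + 1 + k) * (n + 1 - k) / ((2 * n + 1) * (2 * n + 3))) *
        Real.sqrt ((2 * (n + 1) + 1) / (4 * Real.pi) * ((n - k + 1) * A / ((n + k + 1) * B))) *
        Real.sqrt ((2 * n + 1) / (4 * Real.pi) * (A / B)) = (n + 1 - k) * A / (4 * Real.pi * B) := by
      have hx' : (0:ℝ) < n - k + 1 := by linarith
      rw [← Real.sqrt_mul (by positivity), ← Real.sqrt_mul (by positivity),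
        ← Real.sqrt_sq (show 0 ≤ (n + 1 - k) * A / (4 * Real.pi * B) by positivity)]
      congr 1
      field_simp
      ring
    have h6 : ((-1 : ℝ) ^ k) * (-1) ^ k = 1 := by rw [← mul_pow]; simp
    calc _ = 4 * Real.pi * (Real.sqrt (((n : ℝ) + 1 + k) * (n + 1 - k) / ((2 * n + 1) * (2 * n + 3))) *
        Real.sqrt ((2 * (n + 1) + 1) / (4 * Real.pi) * ((n - k + 1) * A / ((n + k + 1) * B))) *
        Real.sqrt ((2 * n + 1) / (4 * Real.pi) * (A / B))) * B * ((-1 : ℝ) ^ k * (-1) ^ k) := by ring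
      _ = _ := by
        rw [h5, h6]; field_simp; ring
  rw [← h3]; ring

/-- At the equator the coefficients of the addition theorem reduce to the numbers `ν_n^m`. -/
lemma coefL_mul_regR (n : ℕ) (m : ℤ) (v : E3) :
    ((4 * Real.pi / (2 * n + 1) * coefL n m : ℝ) : ℂ) * regR n (-m) v =
      coefNu n m * solidH n (-m) v := by
  rcases lt_or_ge n m.natAbs with h | h
  · rw [regR_of_lt (by simpa using h), solidH_of_lt (by simpa using h)]; simp
  · rw [regR_eq, normConst_neg, Int.natAbs_neg, ← coefL_mul_normConst h]
    push_cast; ring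

lemma coefA_mul_coefL_mul_regR (n : ℕ) (m : ℤ) (v : E3) :
    ((4 * Real.pi * coefA n m * coefL (n + 1) m : ℝ) : ℂ) * regR n (-m) v =
      coefNu (n + 1) m * solidH n (-m) v := by
  rcases lt_or_ge n m.natAbs with h | h
  · rw [regR_of_lt (by simpa using h), solidH_of_lt (by simpa using h)]; simp
  · rw [regR_eq, normConst_neg, Int.natAbs_neg, ← coefA_mul_coefL h]
    push_cast; ring

/-! ### The generating function -/

/-- Coefficient of `z ^ c * W ^ a * W' ^ b`, for `q = (c, a, b)`, in the trigonometric sum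
`∑ m, ν_{n+ε}^m H_n^m e^(-i m φ)`, where `H_n^m` is `solidH n m`. The values `ε = 0` and `ε = 1`
belong to Green's function and to its vertical derivative. -/
noncomputable def equatorCoef (ε : ℕ) (q : ℕ × ℕ × ℕ) : ℝ :=
  coefNu (q.1 + q.2.1 + q.2.2 + ε) ((q.2.1 : ℤ) - q.2.2) *
    ((-1) ^ ((q.2.1 : ℤ) - q.2.2).natAbs / 2 ^ (q.1 + q.2.1 + q.2.2)) *
    ((-1) ^ (min q.2.1 q.2.2) * 2 ^ q.1 / (q.1.factorial * q.2.1.factorial * q.2.2.factorial))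

/-- The two arguments of the double factorials are `n - |m|` and `n + |m|` in one order or the
other, depending on the sign of `m = a - b`. -/
lemma coefNu_diff (N a b : ℕ) : coefNu (2 * N + a + b) ((a : ℤ) - b) =
    (-1) ^ (N + max a b) * (2 * (N + a) - 1).doubleFactorial *
      (2 * (N + b) - 1).doubleFactorial := by
  have hp : parityL (2 * N + a + b) ((a : ℤ) - b) = 1 := by
    rw [parityL, if_pos]
    exact ⟨N + a, by push_cast; ring⟩
  rw [coefNu, hp, one_mul]
  rcases le_total a b with h | h
  · rw [max_eq_right h, show (2 * N + a + b + ((a : ℤ) - b).natAbs) / 2 = N + b by omega,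
      show 2 * N + a + b - ((a : ℤ) - b).natAbs = 2 * (N + a) by omega,
      show 2 * N + a + b + ((a : ℤ) - b).natAbs = 2 * (N + b) by omega]
  · rw [max_eq_left h, show (2 * N + a + b + ((a : ℤ) - b).natAbs) / 2 = N + a by omega,
      show 2 * N + a + b - ((a : ℤ) - b).natAbs = 2 * (N + b) by omega,
      show 2 * N + a + b + ((a : ℤ) - b).natAbs = 2 * (N + a) by omega]
    ring

/-- Rising factorial of a real number. -/
noncomputable def rising (s : ℝ) (n : ℕ) : ℝ := ∏ i ∈ Finset.range n, (s + i)

lemma binCoef_eq_rising (s : ℝ) (n : ℕ) : binCoef s n = rising s n / (n.factorial : ℝ) := rfl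

lemma rising_add (s : ℝ) (m n : ℕ) : rising s (m + n) = rising s m * rising (s + m) n := by
  rw [rising, Finset.prod_range_add]
  simp [rising, add_assoc]

lemma rising_pos {s : ℝ} (hs : 0 < s) (n : ℕ) : 0 < rising s n :=
  Finset.prod_pos fun i _ => by positivity

lemma doubleFactorial_eq_rising (n : ℕ) :
    ((2 * n - 1).doubleFactorial : ℝ) = 2 ^ n * rising (1 / 2) n := by
  induction n with
  | zero => simp [rising]
  | succ n ih =>
    rw [rising_add _ n 1, pow_succ]
    have : rising (1 / 2 + n) 1 = 1 / 2 + n := by simp [rising]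
    rw [this]
    cases n with
    | zero => simp [rising]
    | succ n =>
      rw [show 2 * (n + 1 + 1) - 1 = 2 * n + 1 + 2 by omega, Nat.doubleFactorial_add_two]
      rw [show 2 * (n + 1) - 1 = 2 * n + 1 by omega] at ih
      push_cast
      rw [ih]
      ring

lemma factorial_eq_rising {ε : ℕ} (hε : ε = 0 ∨ ε = 1) (j : ℕ) :
    ((2 * j + ε).factorial : ℝ) = 2 ^ (2 * j + ε) * rising (1 / 2) (j + ε) * j.factorial := by
  have h0 : ((2 * j).factorial : ℝ) = 2 ^ (2 * j) * rising (1 / 2) j * j.factorial := by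
    have h := doubleFactorial_odd j
    rw [doubleFactorial_eq_rising, eq_div_iff (by positivity)] at h
    rw [← h]; ring
  rcases hε with rfl | rfl
  · exact h0
  · rw [Nat.factorial_succ, rising_add, Nat.cast_mul, h0]
    have : rising (1 / 2 + j) 1 = 1 / 2 + j := by simp [rising]
    rw [this]
    push_cast
    ring

lemma neg_one_pow_max_min (a b : ℕ) :
    (-1 : ℝ) ^ (max a b) * (-1) ^ ((a : ℤ) - b).natAbs * (-1) ^ (min a b) = 1 := by
  rw [← pow_add, ← pow_add]
  apply Even.neg_one_pow
  rcases le_total a b with h | h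
  · rw [max_eq_right h, min_eq_left h]; exact ⟨b, by omega⟩
  · rw [max_eq_left h, min_eq_right h]; exact ⟨a, by omega⟩

/-- Term-by-term agreement of the solid harmonics at the equator with the triple binomial series for
the exponent `-(1 / 2 + ε)`; the exponent of `z` has the parity of `ε`. -/
lemma equatorCoef_eq {ε : ℕ} (hε : ε = 0 ∨ ε = 1) (j a b : ℕ) :
    equatorCoef ε (2 * j + ε, a, b) = (-1) ^ ε * ((-1) ^ j * binCoef (1 / 2 + ε) j *
      (binCoef (1 / 2 + ε + j) a * binCoef (1 / 2 + ε + j) b)) := by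
  have hP : ∀ N, rising (1 / 2) (ε + N) = rising (1 / 2) ε * rising (1 / 2 + ε) N :=
    fun N => rising_add _ _ _
  have h2 : 2 ^ ε * rising (1 / 2) ε = 1 := by rcases hε with rfl | rfl <;> simp [rising]
  have h3 : 0 < rising (1 / 2 + ε) j := rising_pos (by positivity) j
  have h4 : 0 < rising (1 / 2) ε := rising_pos (by positivity) ε
  have h5 := neg_one_pow_max_min a b
  have e1 : equatorCoef ε (2 * j + ε, a, b) =
      ((-1) ^ (max a b) * (-1) ^ ((a : ℤ) - b).natAbs * (-1) ^ (min a b)) *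
      ((-1) ^ (j + ε) * (2 ^ (j + ε + a) * rising (1 / 2) (ε + (j + a)) *
        (2 ^ (j + ε + b) * rising (1 / 2) (ε + (j + b)))) * 2 ^ (2 * j + ε) /
        (2 ^ (2 * j + ε + a + b) * (2 ^ (2 * j + ε) * rising (1 / 2) (ε + j) * j.factorial *
          a.factorial * b.factorial))) := by
    rw [equatorCoef]
    dsimp only
    rw [show 2 * j + ε + a + b + ε = 2 * (j + ε) + a + b by ring, coefNu_diff,
      doubleFactorial_eq_rising, doubleFactorial_eq_rising, factorial_eq_rising hε,
      show j + ε + a = ε + (j + a) by ring, show j + ε + b = ε + (j + b) by ring, add_comm j ε,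
      pow_add _ _ (max a b)]
    field_simp
  rw [e1, h5, one_mul, hP, hP, hP, rising_add _ j a, rising_add _ j b]
  simp only [binCoef_eq_rising]
  rw [pow_add (-1 : ℝ) j ε]
  generalize rising (1 / 2 + (ε : ℝ)) j = X at *
  generalize rising (1 / 2 + (ε : ℝ) + j) a = A at *
  generalize rising (1 / 2 + (ε : ℝ) + j) b = B at *
  field_simp
  have h6 : (2 : ℝ) ^ (j + ε + a) * 2 ^ (j + ε + b) * rising (1 / 2) ε = 2 ^ (2 * j + ε + a + b) := by
    calc _ = (2 : ℝ) ^ (2 * j + ε + a + b) * (2 ^ ε * rising (1 / 2) ε) := by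
          ring
      _ = _ := by rw [h2, mul_one]
  linear_combination (A * B) * h6

lemma equatorCoef_odd {ε c a b : ℕ} (h : ¬ Even (c + ε)) : equatorCoef ε (c, a, b) = 0 := by
  have : parityL (c + a + b + ε) ((a : ℤ) - b) = 0 := by
    rw [parityL, if_neg]
    rw [Int.even_iff]
    rw [Nat.even_iff] at h
    push_cast
    omega
  rw [equatorCoef, coefNu, this]; simp

/-- Homogeneous polynomial of degree `n` in `(z, W, W')`: the coefficient of `t ^ n` in
`(-t z) ^ ε (|1 - t W| ^ 2 + t ^ 2 z ^ 2) ^ (- 1 / 2 - ε)` when `W' = conj W`. -/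
noncomputable def equatorPoly (ε n : ℕ) (z : ℝ) (W W' : ℂ) : ℂ :=
  ∑ q ∈ triples n, equatorCoef ε q * (z ^ q.1 * W ^ q.2.1 * W' ^ q.2.2)

lemma hasSum_equatorPoly_small {ε : ℕ} (hε : ε = 0 ∨ ε = 1) {z t : ℝ} {W : ℂ}
    (h : |t * z| < 1 - ‖t * W‖) :
    HasSum (fun n => (t : ℂ) ^ n * equatorPoly ε n z W (starRingEnd ℂ W))
      (((-(t * z)) ^ ε * (Complex.normSq (1 - t * W) + (t * z) ^ 2) ^ (-(1 / 2 + ε : ℝ)) : ℝ) : ℂ) := by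
  have h1 := (hasSum_tripleTerm (s := 1 / 2 + ε) (by positivity) h).mul_left
    (((-(t * z)) ^ ε : ℝ) : ℂ)
  rw [← Complex.ofReal_mul] at h1
  let i : ℕ × ℕ × ℕ → ℕ × ℕ × ℕ := fun q => (2 * q.1 + ε, q.2)
  have hi : Function.Injective i := by
    rintro ⟨a, b⟩ ⟨c, d⟩ h
    simp only [i, Prod.mk.injEq] at h
    ext1
    · simp; omega
    · exact h.2
  let g : ℕ × ℕ × ℕ → ℂ := fun q => (t : ℂ) ^ (q.1 + q.2.1 + q.2.2) *
    (equatorCoef ε q * (z ^ q.1 * W ^ q.2.1 * (starRingEnd ℂ W) ^ q.2.2))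
  have h2 : HasSum g (((-(t * z)) ^ ε *
      (Complex.normSq (1 - t * W) + (t * z) ^ 2) ^ (-(1 / 2 + ε : ℝ)) : ℝ) : ℂ) := by
    rw [← hi.hasSum_iff]
    · refine h1.of_eq (fun q => ?_) rfl
      obtain ⟨j, a, b⟩ := q
      simp only [Function.comp, g, i, equatorCoef_eq hε, tripleTerm, pairTerm, map_mul,
        Complex.conj_ofReal]
      push_cast
      rw [neg_pow ((t : ℂ) * z)]
      ring
    · rintro ⟨c, a, b⟩ hq
      have : ¬ Even (c + ε) := by
        rintro ⟨r, hr⟩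
        apply hq
        refine ⟨(r - ε, a, b), ?_⟩
        simp only [i]
        congr 1
        rcases hε with rfl | rfl <;> omega
      simp only [g, equatorCoef_odd this]
      simp
  refine (h2.sum_fiber (fun q => q.1 + q.2.1 + q.2.2) triples (fun n q => mem_triples)).of_eq
    (fun n => ?_) rfl
  rw [equatorPoly, Finset.mul_sum]
  refine Finset.sum_congr rfl fun q hq => ?_
  simp only [g]
  rw [mem_triples.1 hq]

/-- The complex number `μ` with `|1 - t μ| ^ 2 = |1 - t W| ^ 2 + t ^ 2 z ^ 2` for all real `t`. -/
noncomputable def liftPoint (z : ℝ) (W : ℂ) : ℂ := ⟨W.re, Real.sqrt (W.im ^ 2 + z ^ 2)⟩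

lemma norm_liftPoint_sq (z : ℝ) (W : ℂ) : ‖liftPoint z W‖ ^ 2 = ‖W‖ ^ 2 + z ^ 2 := by
  rw [← Complex.normSq_eq_norm_sq, ← Complex.normSq_eq_norm_sq, Complex.normSq_apply,
    Complex.normSq_apply, liftPoint]
  dsimp only
  rw [Real.mul_self_sqrt (by positivity)]
  ring

lemma normSq_one_sub_liftPoint (z t : ℝ) (W : ℂ) :
    Complex.normSq (1 - t * liftPoint z W) = Complex.normSq (1 - t * W) + (t * z) ^ 2 := by
  have h : Real.sqrt (W.im ^ 2 + z ^ 2) ^ 2 = W.im ^ 2 + z ^ 2 := Real.sq_sqrt (by positivity)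
  simp only [Complex.normSq_apply, liftPoint, Complex.sub_re, Complex.sub_im, Complex.one_re,
    Complex.one_im, Complex.mul_re, Complex.mul_im, Complex.ofReal_re, Complex.ofReal_im]
  linear_combination t ^ 2 * h

/-- The coefficient of `t ^ n` in `(-t z) ^ ε (|1 - t W| ^ 2 + t ^ 2 z ^ 2) ^ (- 1 / 2 - ε)`, in
terms of Gegenbauer polynomials. The factor `z ^ ε` shifts the degree by `ε`. -/
noncomputable def shiftGegen (ε n : ℕ) (z : ℝ) (W : ℂ) : ℂ :=
  if ε ≤ n then (-z) ^ ε * gegen (1 / 2 + ε) (liftPoint z W) (n - ε) else 0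

lemma hasSum_shiftGegen (ε : ℕ) {z t : ℝ} {W : ℂ} (h : |t| * ‖liftPoint z W‖ < 1) :
    HasSum (fun n => (t : ℂ) ^ n * shiftGegen ε n z W)
      (((-(t * z)) ^ ε * (Complex.normSq (1 - t * W) + (t * z) ^ 2) ^ (-(1 / 2 + ε : ℝ)) : ℝ) : ℂ) := by
  have h1 := (hasSum_gegen (s := 1 / 2 + ε) (by positivity) h).mul_left
    (((-(t * z)) ^ ε : ℝ) : ℂ)
  rw [← Complex.ofReal_mul, normSq_one_sub_liftPoint] at h1
  rw [← (add_left_injective ε).hasSum_iff]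
  · refine h1.of_eq (fun n => ?_) rfl
    simp only [Function.comp, shiftGegen, le_add_iff_nonneg_left, zero_le, if_true,
      Nat.add_sub_cancel, pow_add]
    push_cast
    rw [← mul_neg, mul_pow]
    ring
  · intro n hn
    have : ¬ ε ≤ n := fun hle => hn ⟨n - ε, by simp; omega⟩
    simp [shiftGegen, this]

lemma equatorPoly_eq {ε : ℕ} (hε : ε = 0 ∨ ε = 1) (n : ℕ) (z : ℝ) (W : ℂ) :
    equatorPoly ε n z W (starRingEnd ℂ W) = shiftGegen ε n z W := by
  -- this radius lies inside both regions of convergence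
  have hδ : 0 < |z| + ‖W‖ + ‖liftPoint z W‖ + 1 := by positivity
  refine congrFun (coeff_unique (p := fun n => equatorPoly ε n z W (starRingEnd ℂ W))
    (q := fun n => shiftGegen ε n z W) (inv_pos.2 hδ) (fun t ht => hasSum_equatorPoly_small hε ?_)
    (fun t ht => hasSum_shiftGegen ε ?_)) n
  · have h1 : |t| * (|z| + ‖W‖ + ‖liftPoint z W‖ + 1) < 1 := by rwa [← lt_inv_mul_iff₀' hδ, mul_one]
    rw [abs_mul, norm_mul, Complex.norm_real, Real.norm_eq_abs]
    nlinarith [mul_nonneg (abs_nonneg t) (norm_nonneg (liftPoint z W)), abs_nonneg t]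
  · have h1 : |t| * (|z| + ‖W‖ + ‖liftPoint z W‖ + 1) < 1 := by rwa [← lt_inv_mul_iff₀' hδ, mul_one]
    nlinarith [mul_nonneg (abs_nonneg t) (norm_nonneg W), abs_nonneg t,
      mul_nonneg (abs_nonneg t) (abs_nonneg z)]

lemma norm_equatorPoly_le {ε : ℕ} (hε : ε = 0 ∨ ε = 1) (n : ℕ) (z : ℝ) (W : ℂ) :
    ‖equatorPoly ε n z W (starRingEnd ℂ W)‖ ≤ (n + 1) ^ 3 * ‖liftPoint z W‖ ^ n := by
  rw [equatorPoly_eq hε, shiftGegen]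
  have hz : |z| ≤ ‖liftPoint z W‖ := by
    apply abs_le_of_sq_le_sq _ (norm_nonneg _)
    rw [norm_liftPoint_sq]; nlinarith [sq_nonneg ‖W‖]
  split_ifs with h
  · obtain ⟨k, rfl⟩ := Nat.exists_eq_add_of_le h
    have hg := norm_gegen_le (s := 1 / 2 + ε) (by positivity)
      (by rcases hε with rfl | rfl <;> norm_num) (liftPoint z W) k
    rw [Nat.add_sub_cancel_left, norm_mul, norm_pow, norm_neg, Complex.norm_real, Real.norm_eq_abs,
      pow_add]
    calc _ ≤ ‖liftPoint z W‖ ^ ε * ((k + 1) ^ 3 * ‖liftPoint z W‖ ^ k) := by gcongr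
      _ = (k + 1) ^ 3 * (‖liftPoint z W‖ ^ ε * ‖liftPoint z W‖ ^ k) := by ring
      _ ≤ _ := by
        gcongr
        linarith [(Nat.cast_nonneg ε : (0 : ℝ) ≤ ε)]
  · simp; positivity

/-! ### Fourier series in the azimuth -/

/-- The coefficient `ν_{n+ε}^m H_n^{-m}(v)` of `e^(i m φ)` in the expansions along the equator. -/
noncomputable def fourierC (ε n : ℕ) (m : ℤ) (v : E3) : ℂ :=
  coefNu (n + ε) m * solidH n (-m) v

lemma fourierC_of_lt (ε : ℕ) {n : ℕ} {m : ℤ} (h : n < m.natAbs) (v : E3) :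
    fourierC ε n m v = 0 := by
  rw [fourierC, solidH_of_lt (by simpa using h), mul_zero]

lemma sum_fourierC (ε n : ℕ) (v : E3) (φ : ℝ) :
    ∑ m ∈ Finset.Icc (-(n : ℤ)) n, fourierC ε n m v * Complex.exp (Complex.I * m * φ) =
      equatorPoly ε n (v 2) (horiz v * Complex.exp (-(φ * Complex.I)))
        (starRingEnd ℂ (horiz v * Complex.exp (-(φ * Complex.I)))) := by
  have h1 : ∀ m : ℤ, fourierC ε n m v * Complex.exp (Complex.I * m * φ) =
      ∑ q ∈ triples n, if (q.2.2 : ℤ) - q.2.1 = m then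
        (equatorCoef ε q * ((v 2 : ℂ) ^ q.1 * (horiz v * Complex.exp (-(φ * Complex.I))) ^ q.2.1 *
        (starRingEnd ℂ (horiz v * Complex.exp (-(φ * Complex.I)))) ^ q.2.2)) else 0 := by
    intro m
    rw [fourierC, solidH_eq, ← Finset.sum_filter, Finset.mul_sum, Finset.mul_sum, Finset.sum_mul]
    refine Finset.sum_congr ?_ fun q hq => ?_
    · ext q
      simp only [Finset.mem_filter]
      exact and_congr_right fun _ => by omega
    · rw [Finset.mem_filter] at hq
      have hm : (q.2.1 : ℤ) - q.2.2 = -m := by omega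
      have hE : Complex.exp (Complex.I * m * φ) = Complex.exp (-(φ * Complex.I)) ^ q.2.1 *
          Complex.exp (φ * Complex.I) ^ q.2.2 := by
        rw [← Complex.exp_nat_mul, ← Complex.exp_nat_mul, ← Complex.exp_add, ← hq.2]
        congr 1; push_cast; ring
      rw [equatorCoef, hm, mem_triples.1 hq.1, coefNu_neg, solidTerm, map_mul, ← Complex.exp_conj,
        map_neg, map_mul, Complex.conj_I, Complex.conj_ofReal, mul_neg, neg_neg, hE, mul_pow,
        mul_pow]
      push_cast
      rw [mul_pow]
      ring
  rw [Finset.sum_congr rfl fun m _ => h1 m, Finset.sum_comm, equatorPoly]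
  refine Finset.sum_congr rfl fun q hq => ?_
  rw [Finset.sum_ite_eq, if_pos]
  have := mem_triples.1 hq
  rw [Finset.mem_Icc]
  omega

lemma norm_liftPoint (v : E3) (φ : ℝ) :
    ‖liftPoint (v 2) (horiz v * Complex.exp (-(φ * Complex.I)))‖ = ‖v‖ := by
  rw [← sq_eq_sq₀ (norm_nonneg _) (norm_nonneg _), norm_liftPoint_sq, norm_mul,
    show -((φ : ℂ) * Complex.I) = ((-φ : ℝ) : ℂ) * Complex.I by push_cast; ring,
    Complex.norm_exp_ofReal_mul_I, mul_one, norm_horiz_sq, norm_sq_E3]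

lemma norm_exp_int (m : ℤ) (φ : ℝ) : ‖Complex.exp (Complex.I * m * φ)‖ = 1 := by
  rw [show Complex.I * (m : ℂ) * φ = ((m * φ : ℝ) : ℂ) * Complex.I by push_cast; ring,
        Complex.norm_exp_ofReal_mul_I]

lemma integral_exp_int (k : ℤ) : ∫ φ in (0 : ℝ)..(2 * Real.pi), Complex.exp (Complex.I * k * φ) =
    if k = 0 then 2 * Real.pi else 0 := by
  split_ifs with h
  · simp [h]
  · have hk : Complex.I * (k : ℂ) ≠ 0 := by
      simp [h]
    rw [integral_exp_mul_complex hk]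
    have : Complex.exp (Complex.I * k * (2 * Real.pi : ℝ)) = 1 := by
      rw [Complex.exp_eq_one_iff]
      exact ⟨k, by push_cast; ring⟩
    rw [this]
    simp

/-- A coefficient of a trigonometric polynomial is at most the supremum of the polynomial. -/
lemma norm_coeff_le {n : ℕ} {d : ℤ → ℂ} {B : ℝ}
    (hB : ∀ φ : ℝ, ‖∑ m ∈ Finset.Icc (-(n : ℤ)) n, d m * Complex.exp (Complex.I * m * φ)‖ ≤ B)
    {k : ℤ} (hk : k ∈ Finset.Icc (-(n : ℤ)) n) : ‖d k‖ ≤ B := by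
  have h1 : ∫ φ in (0 : ℝ)..(2 * Real.pi), (∑ m ∈ Finset.Icc (-(n : ℤ)) n,
      d m * Complex.exp (Complex.I * m * φ)) * Complex.exp (Complex.I * (-k : ℤ) * φ) =
      2 * Real.pi * d k := by
    have e : ∀ φ : ℝ, (∑ m ∈ Finset.Icc (-(n : ℤ)) n,
        d m * Complex.exp (Complex.I * m * φ)) * Complex.exp (Complex.I * (-k : ℤ) * φ) =
        ∑ m ∈ Finset.Icc (-(n : ℤ)) n, d m * Complex.exp (Complex.I * (m - k : ℤ) * φ) := by
      intro φ
      rw [Finset.sum_mul]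
      refine Finset.sum_congr rfl fun m _ => ?_
      rw [mul_assoc, ← Complex.exp_add]
      congr 2; push_cast; ring
    -- integration against `e^(-i k φ)` isolates the coefficient `d k`
    simp only [e]
    rw [intervalIntegral.integral_finsetSum]
    · simp only [intervalIntegral.integral_const_mul, integral_exp_int, sub_eq_zero]
      rw [Finset.sum_eq_single k]
      · simp; ring
      · intro m _ hm
        simp [hm]
      · intro h; exact absurd hk h
    · intro m _
      exact Continuous.intervalIntegrable (by fun_prop) _ _
  have h2 := intervalIntegral.norm_integral_le_of_norm_le_const (a := 0) (b := 2 * Real.pi) (C := B)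
    (f := fun φ : ℝ => (∑ m ∈ Finset.Icc (-(n : ℤ)) n,
      d m * Complex.exp (Complex.I * m * φ)) * Complex.exp (Complex.I * (-k : ℤ) * φ)) (by
    intro φ _
    rw [norm_mul]
    rw [norm_exp_int, mul_one]
    exact hB φ)
  rw [h1, sub_zero, norm_mul, abs_of_pos Real.two_pi_pos, mul_comm B] at h2
  have h3 : ‖(2 * Real.pi : ℂ)‖ = 2 * Real.pi := by
    simp [abs_of_pos Real.pi_pos]
  rw [h3] at h2
  exact le_of_mul_le_mul_left h2 Real.two_pi_pos

/-- Majorant of the Fourier coefficients; the degree is `p.1` and the order is `p.2`. -/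
noncomputable def majorant (r : ℝ) (p : ℕ × ℤ) : ℝ :=
  if p.2.natAbs ≤ p.1 then ((p.1 : ℝ) + 1) ^ 3 * r ^ p.1 else 0

lemma majorant_nonneg {r : ℝ} (hr : 0 ≤ r) (p : ℕ × ℤ) : 0 ≤ majorant r p := by
  rw [majorant]; split_ifs <;> positivity

lemma norm_fourierC_le {ε : ℕ} (hε : ε = 0 ∨ ε = 1) (n : ℕ) (m : ℤ) (v : E3) :
    ‖fourierC ε n m v‖ ≤ majorant ‖v‖ (n, m) := by
  rw [majorant]
  split_ifs with h
  · refine norm_coeff_le (n := n) (d := fun m => fourierC ε n m v) (fun φ => ?_)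
      (Finset.mem_Icc.2 (by dsimp only at h; omega))
    rw [sum_fourierC]
    refine (norm_equatorPoly_le hε _ _ _).trans ?_
    rw [norm_liftPoint]
  · rw [fourierC_of_lt _ (by simpa using h)]; simp

lemma summable_majorant {r : ℝ} (hr : 0 ≤ r) (hr1 : r < 1) : Summable (majorant r) := by
  refine (summable_prod_of_nonneg fun p => majorant_nonneg hr p).2 ⟨fun n => ?_, ?_⟩
  · refine summable_of_ne_finset_zero (s := Finset.Icc (-(n : ℤ)) n) fun m hm => ?_
    rw [majorant, if_neg]
    rw [Finset.mem_Icc] at hm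
    dsimp only; omega
  · have h1 : ∀ n : ℕ, ∑' m, majorant r (n, m) ≤ 2 * (16 * (n ^ 4 * r ^ n) + r ^ n) := by
      intro n
      rw [tsum_eq_sum (s := Finset.Icc (-(n : ℤ)) n)]
      · have h2 : ∀ m ∈ Finset.Icc (-(n : ℤ)) n, majorant r (n, m) ≤ (n + 1) ^ 3 * r ^ n := by
          intro m _
          rw [majorant]
          split_ifs
          · exact le_rfl
          · positivity
        refine (Finset.sum_le_sum h2).trans ?_
        rw [Finset.sum_const, Int.card_Icc, nsmul_eq_mul]
        have h3 : (((n : ℤ) + 1 - -(n : ℤ)).toNat : ℝ) = 2 * n + 1 := by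
          rw [show ((n : ℤ) + 1 - -(n : ℤ)).toNat = 2 * n + 1 by omega]; push_cast; rfl
        rw [h3]
        have h4 : ((n : ℝ) + 1) ^ 4 ≤ 16 * n ^ 4 + 1 := by
          rcases n.eq_zero_or_pos with rfl | hn
          · simp
          · have : (1 : ℝ) ≤ n := by exact_mod_cast hn
            calc ((n : ℝ) + 1) ^ 4 ≤ (2 * n) ^ 4 := by gcongr; linarith
              _ ≤ _ := by rw [mul_pow]; norm_num
        have h5 : 0 ≤ r ^ n := by positivity
        calc (2 * (n : ℝ) + 1) * ((n + 1) ^ 3 * r ^ n) ≤ (2 * (n + 1)) * ((n + 1) ^ 3 * r ^ n) := by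
              gcongr; linarith
          _ = 2 * ((n + 1) ^ 4 * r ^ n) := by ring
          _ ≤ 2 * ((16 * n ^ 4 + 1) * r ^ n) := by gcongr
          _ = _ := by ring
      · intro m hm
        rw [majorant, if_neg]
        rw [Finset.mem_Icc] at hm
        dsimp only; omega
    refine Summable.of_nonneg_of_le (fun n => tsum_nonneg fun m => majorant_nonneg hr _) h1 ?_
    have hr' : ‖r‖ < 1 := by rwa [Real.norm_of_nonneg hr]
    exact (((summable_pow_mul_geometric_of_norm_lt_one 4 hr').mul_left 16).add
      (summable_geometric_of_lt_one hr hr1)).mul_left 2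

lemma majorant_mul (r t : ℝ) (p : ℕ × ℤ) : majorant (t * r) p = t ^ p.1 * majorant r p := by
  rw [majorant, majorant]
  split_ifs
  · rw [mul_pow]; ring
  · simp

/-- Expansion of `(-t z) ^ ε |t v - e_φ| ^ (-1 - 2 ε)`, where `e_φ` is the unit vector of azimuth
`φ` in the horizontal plane. -/
lemma hasSum_fourierC {ε : ℕ} (hε : ε = 0 ∨ ε = 1) (v : E3) (φ : ℝ) {t : ℝ} (ht : 0 ≤ t)
    (htv : t * ‖v‖ < 1) :
    HasSum (fun p : ℕ × ℤ => (t : ℂ) ^ p.1 *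
        (fourierC ε p.1 p.2 v * Complex.exp (Complex.I * p.2 * φ)))
      (((-(t * v 2)) ^ ε * (1 - 2 * t * (v 0 * Real.cos φ + v 1 * Real.sin φ) + (t * ‖v‖) ^ 2) ^
        (-(1 / 2 + ε : ℝ)) : ℝ) : ℂ) := by
  set W := horiz v * Complex.exp (-(φ * Complex.I)) with hW
  have hs : Summable (fun p : ℕ × ℤ => (t : ℂ) ^ p.1 *
        (fourierC ε p.1 p.2 v * Complex.exp (Complex.I * p.2 * φ))) := by
    refine Summable.of_norm_bounded (summable_majorant (by positivity) htv) fun p => ?_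
    rw [majorant_mul, norm_mul, norm_mul, norm_exp_int, mul_one, norm_pow, Complex.norm_real,
      Real.norm_of_nonneg ht]
    gcongr
    exact norm_fourierC_le hε _ _ _
  have h1 : ∀ n : ℕ, HasSum (fun m : ℤ => (t : ℂ) ^ n *
      (fourierC ε n m v * Complex.exp (Complex.I * m * φ)))
      ((t : ℂ) ^ n * shiftGegen ε n (v 2) W) := by
    intro n
    refine HasSum.mul_left _ ?_
    rw [← equatorPoly_eq hε, ← sum_fourierC]
    refine hasSum_sum_of_ne_finset_zero fun m hm => ?_
    rw [fourierC_of_lt, zero_mul]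
    rw [Finset.mem_Icc] at hm
    omega
  have h2 := hs.hasSum.prod_fiberwise h1
  have h3 := hasSum_shiftGegen ε (z := v 2) (t := t) (W := W) (by
    rwa [norm_liftPoint, abs_of_nonneg ht])
  refine hs.hasSum.of_eq (fun _ => rfl) ?_
  rw [h2.unique h3]
  -- it remains to identify `|1 - t W| ^ 2 + t ^ 2 z ^ 2`
  have hre : W = ⟨v 0 * Real.cos φ + v 1 * Real.sin φ, v 1 * Real.cos φ - v 0 * Real.sin φ⟩ := by
    rw [hW, show -((φ : ℂ) * Complex.I) = ((-φ : ℝ) : ℂ) * Complex.I by push_cast; ring,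
      Complex.exp_mul_I, ← Complex.ofReal_cos, ← Complex.ofReal_sin, Real.cos_neg, Real.sin_neg]
    apply Complex.ext <;> simp only [horiz, Complex.add_re, Complex.add_im, Complex.mul_re,
      Complex.mul_im, Complex.ofReal_re, Complex.ofReal_im, Complex.I_re, Complex.I_im] <;> ring
  congr 3
  rw [hre, mul_pow, norm_sq_E3]
  simp only [Complex.normSq_apply, Complex.sub_re, Complex.sub_im, Complex.one_re,
    Complex.one_im, Complex.mul_re, Complex.mul_im, Complex.ofReal_re, Complex.ofReal_im]
  linear_combination (-t ^ 2 * (v 0 ^ 2 + v 1 ^ 2)) * Real.sin_sq_add_cos_sq φ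

/-! ### The integrand along the ground plane -/

/-- The point of the plane with polar coordinates `s`, `φ`. -/
noncomputable def polarPt (s φ : ℝ) : ℝ × ℝ := (s * Real.cos φ, s * Real.sin φ)

/-- Distance from a point to a point of the ground plane. -/
noncomputable def planeDist (v : E3) (p : ℝ × ℝ) : ℝ := ‖planePoint p 0 - v‖

lemma planeDist_nonneg (v : E3) (p : ℝ × ℝ) : 0 ≤ planeDist v p := norm_nonneg _

lemma planeDist_sq (v : E3) (p : ℝ × ℝ) :
    planeDist v p ^ 2 = (p.1 - v 0) ^ 2 + (p.2 - v 1) ^ 2 + v 2 ^ 2 := by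
  rw [planeDist, norm_sq_E3]
  simp [planePoint]

lemma planeDist_eq (v : E3) (p : ℝ × ℝ) :
    planeDist v p = Real.sqrt ((p.1 - v 0) ^ 2 + (p.2 - v 1) ^ 2 + v 2 ^ 2) := by
  rw [← planeDist_sq, Real.sqrt_sq (planeDist_nonneg v p)]

lemma measurable_planeDist (v : E3) : Measurable (planeDist v) := by
  have : planeDist v = fun p => Real.sqrt ((p.1 - v 0) ^ 2 + (p.2 - v 1) ^ 2 + v 2 ^ 2) :=
    funext (planeDist_eq v)
  rw [this]; fun_prop

lemma planeDist_zero_sq (p : ℝ × ℝ) : planeDist 0 p ^ 2 = p.1 ^ 2 + p.2 ^ 2 := by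
  rw [planeDist_sq]; simp

lemma planeDist_zero_polarPt {s : ℝ} (hs : 0 ≤ s) (φ : ℝ) : planeDist 0 (polarPt s φ) = s := by
  rw [← sq_eq_sq₀ (planeDist_nonneg _ _) hs, planeDist_zero_sq, polarPt]
  linear_combination s ^ 2 * Real.sin_sq_add_cos_sq φ

lemma le_planeDist_zero {R : ℝ} {p : ℝ × ℝ} (hp : p ∈ groundSet R) : R ≤ planeDist 0 p := by
  refine le_of_sq_le_sq ?_ (norm_nonneg _)
  rw [planeDist_zero_sq]; exact hp

lemma exists_polarPt (p : ℝ × ℝ) : ∃ φ, p = polarPt (planeDist 0 p) φ := by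
  refine ⟨Complex.arg ⟨p.1, p.2⟩, ?_⟩
  have h : planeDist 0 p = ‖(⟨p.1, p.2⟩ : ℂ)‖ := by
    rw [planeDist_eq, Complex.norm_eq_sqrt_sq_add_sq]; simp
  rw [h, polarPt, Complex.norm_mul_cos_arg, Complex.norm_mul_sin_arg]

lemma planeDist_pos {R : ℝ} {v : E3} (hv : ‖v‖ < R) {p : ℝ × ℝ} (hp : p ∈ groundSet R) :
    0 < planeDist v p := by
  have h1 := le_planeDist_zero hp
  have h2 := norm_sub_norm_le (planePoint p 0) v
  rw [planeDist, sub_zero] at h1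
  rw [planeDist]; linarith

lemma planeDist_ge {R : ℝ} {v : E3} (hR : 0 < R) {p : ℝ × ℝ}
    (hp : p ∈ groundSet R) : (1 - ‖v‖ / R) * planeDist 0 p ≤ planeDist v p := by
  have h1 := le_planeDist_zero hp
  have h2 := norm_sub_norm_le (planePoint p 0) v
  have h3 : ‖v‖ ≤ ‖v‖ / R * planeDist 0 p := by
    rw [div_mul_eq_mul_div, le_div_iff₀ hR]
    gcongr
  rw [planeDist, sub_zero] at *
  rw [planeDist]
  linarith

lemma sphY_equator (n : ℕ) (m : ℤ) (φ : ℝ) : sphY n m (Real.pi / 2) φ =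
    (coefL n m : ℂ) * Complex.exp (Complex.I * (m : ℂ) * (φ : ℂ)) := by
  rw [sphY, Real.cos_pi_div_two, coefL]

lemma singS_polarPt (n : ℕ) (m : ℤ) {s : ℝ} (hs : 0 < s) (φ : ℝ) :
    singS n m (planePoint (polarPt s φ) 0) = ((s ^ (n + 1))⁻¹ : ℝ) *
      ((coefL n m : ℂ) * Complex.exp (Complex.I * m * φ)) := by
  have h1 : ‖planePoint (polarPt s φ) 0‖ = s := by
    have := planeDist_zero_polarPt hs.le φ
    rwa [planeDist, sub_zero] at this
  have h2 : polarAngle (planePoint (polarPt s φ) 0) = Real.pi / 2 := by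
    simp [polarAngle, planePoint]
  have h3 : Complex.exp (Complex.I * m * azimuth (planePoint (polarPt s φ) 0)) =
      Complex.exp (Complex.I * m * φ) := by
    have e : (⟨(planePoint (polarPt s φ) 0) 0, (planePoint (polarPt s φ) 0) 1⟩ : ℂ) =
        s * Complex.exp (φ * Complex.I) := by
      rw [Complex.exp_mul_I, ← Complex.ofReal_cos, ← Complex.ofReal_sin]
      apply Complex.ext <;> simp only [planePoint, polarPt, Complex.add_re, Complex.add_im,
        Complex.mul_re, Complex.mul_im, Complex.ofReal_re, Complex.ofReal_im, Complex.I_re,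
        Complex.I_im] <;> simp
    have e2 : Complex.exp (azimuth (planePoint (polarPt s φ) 0) * Complex.I) =
        Complex.exp (φ * Complex.I) := by
      rw [azimuth, e]
      have h := Complex.norm_mul_exp_arg_mul_I (s * Complex.exp (φ * Complex.I))
      rw [norm_mul, Complex.norm_exp_ofReal_mul_I, mul_one, Complex.norm_real,
        Real.norm_of_nonneg hs.le] at h
      exact mul_left_cancel₀ (by exact_mod_cast hs.ne') h
    have e3 : ∀ a : ℝ, Complex.exp (Complex.I * m * a) = Complex.exp (a * Complex.I) ^ m := by
      intro a
      rw [← Complex.exp_int_mul]; congr 1; ring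
    rw [e3, e3, e2]
  rw [singS, h1, h2, sphY_equator, h3]

lemma rpow_neg_half (d : ℝ) (hd : 0 ≤ d) (ε : ℕ) :
    (d ^ 2) ^ (-(1 / 2 + ε : ℝ)) = (d ^ (1 + 2 * ε))⁻¹ := by
  rw [Real.rpow_neg (by positivity), ← Real.rpow_natCast d 2, ← Real.rpow_mul hd,
    ← Real.rpow_natCast d]
  congr 2
  push_cast; ring

/-- Expansion of `(-z_v) ^ ε / |x' - v| ^ (1 + 2 ε)` at a point `x'` of the plane with
`|v| < |x'|`. -/
lemma hasSum_fourierC_polarPt {ε : ℕ} (hε : ε = 0 ∨ ε = 1) {v : E3} {s : ℝ} (hs : 0 < s)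
    (hv : ‖v‖ < s) (φ : ℝ) :
    HasSum (fun p : ℕ × ℤ => ((s ^ (p.1 + 1 + ε))⁻¹ : ℝ) *
        (fourierC ε p.1 p.2 v * Complex.exp (Complex.I * p.2 * φ)))
      (((-v 2) ^ ε * (planeDist v (polarPt s φ) ^ (1 + 2 * ε))⁻¹ : ℝ) : ℂ) := by
  have h := (hasSum_fourierC hε v φ (t := s⁻¹) (by positivity) (by
    rwa [inv_mul_lt_iff₀ hs, mul_one])).mul_left (((s⁻¹) ^ (1 + ε) : ℝ) : ℂ)
  refine h.of_eq (fun p => ?_) ?_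
  · push_cast
    rw [← inv_pow, show p.1 + 1 + ε = 1 + ε + p.1 by ring, pow_add _ (1 + ε) p.1]
    ring
  · rw [← Complex.ofReal_mul]
    congr 1
    have e : 1 - 2 * s⁻¹ * (v 0 * Real.cos φ + v 1 * Real.sin φ) + (s⁻¹ * ‖v‖) ^ 2 =
        (s⁻¹ * planeDist v (polarPt s φ)) ^ 2 := by
      rw [mul_pow, mul_pow, planeDist_sq, norm_sq_E3, polarPt]
      have : s⁻¹ * s = 1 := inv_mul_cancel₀ hs.ne'
      field_simp
      linear_combination (-s ^ 2) * Real.sin_sq_add_cos_sq φ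
    rw [e, rpow_neg_half _ (mul_nonneg (by positivity) (planeDist_nonneg _ _)), mul_pow, mul_inv,
      ← mul_neg, mul_pow]
    have h2 : (s⁻¹ ^ (1 + 2 * ε))⁻¹ = s ^ (1 + ε) * s ^ ε := by
      rw [← pow_add, inv_pow, inv_inv]; congr 1; ring
    rw [h2, inv_pow, inv_pow]
    field_simp

/-- Summands of the expansion of `1 / |x' - v|` as products of regular and singular harmonics. -/
lemma fourierC_zero_eq (n : ℕ) (m : ℤ) (v : E3) {s : ℝ} (hs : 0 < s) (φ : ℝ) :
    ((s ^ (n + 1 + 0))⁻¹ : ℝ) * (fourierC 0 n m v * Complex.exp (Complex.I * m * φ)) =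
      ((4 * Real.pi / (2 * n + 1) : ℝ) : ℂ) * regR n (-m) v *
        singS n m (planePoint (polarPt s φ) 0) := by
  rw [singS_polarPt n m hs, fourierC, add_zero, add_zero, ← coefL_mul_regR]
  push_cast
  ring

/-- Summands of the expansion of `-z_v / |x' - v| ^ 3` as products of regular and singular
harmonics. -/
lemma fourierC_one_eq (n : ℕ) (m : ℤ) (v : E3) {s : ℝ} (hs : 0 < s) (φ : ℝ) :
    ((s ^ (n + 1 + 1))⁻¹ : ℝ) * (fourierC 1 n m v * Complex.exp (Complex.I * m * φ)) =
      ((4 * Real.pi * coefA n m : ℝ) : ℂ) * regR n (-m) v *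
        singS (n + 1) m (planePoint (polarPt s φ) 0) := by
  rw [singS_polarPt (n + 1) m hs, fourierC, ← coefA_mul_coefL_mul_regR]
  push_cast
  ring

/-- Summands of the fourfold expansion of the integrand; `q = ((n, m), (n', m'))`. -/
noncomputable def productTerm (y x : E3) (q : (ℕ × ℤ) × (ℕ × ℤ)) (p : ℝ × ℝ) : ℂ :=
  ((2 * coefA q.2.1 q.2.2 / (2 * (q.1.1 : ℝ) + 1) : ℝ) : ℂ) * regR q.1.1 (-q.1.2) x *
    regR q.2.1 (-q.2.2) y *
    (singS (q.2.1 + 1) q.2.2 (planePoint p 0) * singS q.1.1 q.1.2 (planePoint p 0))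

lemma productTerm_polarPt (y x : E3) (q : (ℕ × ℤ) × (ℕ × ℤ)) {s : ℝ} (hs : 0 < s) (φ : ℝ) :
    productTerm y x q (polarPt s φ) = ((8 * Real.pi ^ 2)⁻¹ : ℝ) *
      ((((s ^ (q.1.1 + 1 + 0))⁻¹ : ℝ) *
        (fourierC 0 q.1.1 q.1.2 x * Complex.exp (Complex.I * q.1.2 * φ))) *
      (((s ^ (q.2.1 + 1 + 1))⁻¹ : ℝ) *
        (fourierC 1 q.2.1 q.2.2 y * Complex.exp (Complex.I * q.2.2 * φ)))) := by
  have hπ : (Real.pi : ℂ) ≠ 0 := by exact_mod_cast Real.pi_ne_zero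
  have h2 : (2 * (q.1.1 : ℂ) + 1) ≠ 0 := by exact_mod_cast Nat.succ_ne_zero (2 * q.1.1)
  rw [fourierC_zero_eq _ _ _ hs, fourierC_one_eq _ _ _ hs, productTerm]
  push_cast
  field_simp
  ring

lemma norm_fourier_le {ε : ℕ} (hε : ε = 0 ∨ ε = 1) (q : ℕ × ℤ) (v : E3) {R s : ℝ} (hR : 0 < R)
    (hs : R ≤ s) (φ : ℝ) : ‖(((s ^ (q.1 + 1 + ε))⁻¹ : ℝ) : ℂ) *
        (fourierC ε q.1 q.2 v * Complex.exp (Complex.I * q.2 * φ))‖ ≤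
      majorant (‖v‖ / R) q * (s ^ (1 + ε))⁻¹ := by
  have hs0 : 0 < s := hR.trans_le hs
  have h1 := norm_fourierC_le hε q.1 q.2 v
  have h2 : majorant (‖v‖ / R) q = (R⁻¹) ^ q.1 * majorant ‖v‖ q := by
    rw [div_eq_inv_mul, majorant_mul]
  have h3 : s⁻¹ ^ q.1 ≤ R⁻¹ ^ q.1 := by gcongr
  rw [norm_mul, norm_mul, norm_exp_int, mul_one, Complex.norm_real,
    Real.norm_of_nonneg (by positivity), h2, show q.1 + 1 + ε = q.1 + (1 + ε) by ring, pow_add,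
    mul_inv]
  calc _ = s⁻¹ ^ q.1 * ‖fourierC ε q.1 q.2 v‖ * (s ^ (1 + ε))⁻¹ := by rw [inv_pow]; ring
    _ ≤ _ := by gcongr

/-- Majorant of the fourfold series. -/
noncomputable def productBound (R : ℝ) (y x : E3) (q : (ℕ × ℤ) × (ℕ × ℤ)) : ℝ :=
  (8 * Real.pi ^ 2)⁻¹ * (majorant (‖x‖ / R) q.1 * majorant (‖y‖ / R) q.2)

lemma summable_productBound {R : ℝ} (hR : 0 < R) {y x : E3} (hy : ‖y‖ < R) (hx : ‖x‖ < R) :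
    Summable (productBound R y x) := by
  have h : ∀ v : E3, ‖v‖ < R → Summable (majorant (‖v‖ / R)) := fun v hv =>
    summable_majorant (by positivity) (by rwa [div_lt_one hR])
  exact ((h x hx).mul_of_nonneg (h y hy) (fun p => majorant_nonneg (by positivity) p)
    (fun p => majorant_nonneg (by positivity) p)).mul_left _

lemma norm_productTerm_le (y x : E3) (q : (ℕ × ℤ) × (ℕ × ℤ)) {R : ℝ} (hR : 0 < R) {p : ℝ × ℝ}
    (hp : p ∈ groundSet R) :
    ‖productTerm y x q p‖ ≤ productBound R y x q * (planeDist 0 p ^ 3)⁻¹ := by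
  have hs := le_planeDist_zero hp
  obtain ⟨φ, hφ⟩ := exists_polarPt p
  generalize planeDist 0 p = s at *
  have hs0 : 0 < s := hR.trans_le hs
  rw [hφ, productTerm_polarPt _ _ _ hs0, norm_mul, norm_mul, Complex.norm_real,
    Real.norm_of_nonneg (by positivity), productBound]
  have h1 := norm_fourier_le (Or.inl rfl) q.1 x hR hs φ
  have h2 := norm_fourier_le (Or.inr rfl) q.2 y hR hs φ
  calc _ ≤ (8 * Real.pi ^ 2)⁻¹ * ((majorant (‖x‖ / R) q.1 * (s ^ (1 + 0))⁻¹) *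
        (majorant (‖y‖ / R) q.2 * (s ^ (1 + 1))⁻¹)) := by
        refine mul_le_mul_of_nonneg_left (mul_le_mul h1 h2 (norm_nonneg _) ?_) (by positivity)
        have := majorant_nonneg (r := ‖x‖ / R) (by positivity) q.1
        positivity
    _ = _ := by
      rw [show (s ^ 3)⁻¹ = (s ^ (1 + 0))⁻¹ * (s ^ (1 + 1))⁻¹ by rw [← mul_inv, ← pow_add]]
      ring

/-- The derivative exists because `y` does not lie at the ground point. -/
lemma greenNormalDeriv_eq {y : E3} {p : ℝ × ℝ} (h : 0 < planeDist y p) :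
    greenNormalDeriv y p = y 2 / (4 * Real.pi * planeDist y p ^ 3) := by
  have e : (fun t => greenFn y (planePoint p t)) = fun t =>
      (4 * Real.pi)⁻¹ * (Real.sqrt ((p.1 - y 0) ^ 2 + (p.2 - y 1) ^ 2 + (y 2 - t) ^ 2))⁻¹ := by
    funext t
    rw [greenFn, one_div, mul_inv]
    congr 2
    rw [← Real.sqrt_sq (norm_nonneg _), norm_sq_E3]
    congr 1
    simp [planePoint]
    ring
  have hD : (p.1 - y 0) ^ 2 + (p.2 - y 1) ^ 2 + (y 2 - 0) ^ 2 = planeDist y p ^ 2 := by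
    rw [planeDist_sq, sub_zero]
  have h1 : HasDerivAt (fun t : ℝ => (p.1 - y 0) ^ 2 + (p.2 - y 1) ^ 2 + (y 2 - t) ^ 2)
      (-(2 * y 2)) 0 := by
    have h2 := ((hasDerivAt_id (0 : ℝ)).const_sub (y 2)).fun_pow 2
    refine (h2.const_add ((p.1 - y 0) ^ 2 + (p.2 - y 1) ^ 2)).congr_deriv ?_
    simp
  have h2 := ((h1.sqrt (by rw [hD]; positivity)).fun_inv (by
    rw [hD, Real.sqrt_sq h.le]; exact h.ne')).const_mul ((4 * Real.pi)⁻¹)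
  rw [greenNormalDeriv, e, h2.deriv, hD, Real.sqrt_sq h.le]
  field_simp

/-- The kernel integrand as an explicit measurable function; the two agree on the domain of
integration. -/
noncomputable def kernelForm (y x : E3) (p : ℝ × ℝ) : ℝ :=
  -y 2 / (8 * Real.pi ^ 2) * ((planeDist x p)⁻¹ * (planeDist y p ^ 3)⁻¹)

lemma kernelIntegrand_eq {R : ℝ} {y : E3} (hy : ‖y‖ < R) (x : E3) {p : ℝ × ℝ}
    (hp : p ∈ groundSet R) : kernelIntegrand y x p = kernelForm y x p := by
  rw [kernelIntegrand, greenNormalDeriv_eq (planeDist_pos hy hp), layerDensity, greenFn, kernelForm,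
    ← planeDist]
  have := planeDist_pos hy hp
  field_simp
  ring

lemma hasSum_mul_of_summable_norm {ι κ : Type*} {f : ι → ℂ} {g : κ → ℂ} {a b : ℂ} (hf : HasSum f a)
    (hg : HasSum g b) (hf' : Summable fun i => ‖f i‖) (hg' : Summable fun i => ‖g i‖) :
    HasSum (fun q : ι × κ => f q.1 * g q.2) (a * b) :=
  hf.mul hg (summable_mul_of_summable_norm' hf' hf.summable hg' hg.summable)

lemma hasSum_productTerm {R : ℝ} (hR : 0 < R) {y x : E3} (hy : ‖y‖ < R) (hx : ‖x‖ < R)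
    {p : ℝ × ℝ} (hp : p ∈ groundSet R) :
    HasSum (fun q => productTerm y x q p) (kernelForm y x p : ℂ) := by
  have hs := le_planeDist_zero hp
  obtain ⟨φ, hφ⟩ := exists_polarPt p
  generalize planeDist 0 p = s at *
  have hs0 : 0 < s := hR.trans_le hs
  have h1 := hasSum_fourierC_polarPt (Or.inl rfl) hs0 (hx.trans_le hs) φ
  have h2 := hasSum_fourierC_polarPt (Or.inr rfl) hs0 (hy.trans_le hs) φ
  have hn : ∀ v : E3, ‖v‖ < R → ∀ ε : ℕ, ε = 0 ∨ ε = 1 → Summable fun q : ℕ × ℤ =>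
      ‖(((s ^ (q.1 + 1 + ε))⁻¹ : ℝ) : ℂ) *
        (fourierC ε q.1 q.2 v * Complex.exp (Complex.I * q.2 * φ))‖ := fun v hv ε hε =>
    Summable.of_nonneg_of_le (fun _ => norm_nonneg _) (fun q => norm_fourier_le hε q v hR hs φ)
      ((summable_majorant (by positivity) (by rwa [div_lt_one hR])).mul_right _)
  have h3 := (hasSum_mul_of_summable_norm h1 h2 (hn x hx 0 (Or.inl rfl))
    (hn y hy 1 (Or.inr rfl))).mul_left (((8 * Real.pi ^ 2)⁻¹ : ℝ) : ℂ)
  refine h3.of_eq (fun q => ?_) ?_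
  · rw [hφ, productTerm_polarPt _ _ _ hs0]
  · rw [hφ, kernelForm]
    push_cast
    ring

/-! ### Integrals over the ground plane -/

lemma measurableSet_groundSet (R : ℝ) : MeasurableSet (groundSet R) :=
  measurableSet_le measurable_const (by fun_prop)

/-- The dominating function: in two dimensions `|x'| ^ (-3)` is integrable away from the origin. -/
lemma integrableOn_planeDist_inv {R : ℝ} (hR : 0 < R) :
    IntegrableOn (fun p => (planeDist 0 p ^ 3)⁻¹) (groundSet R) := by
  have h : Integrable (fun p : ℝ × ℝ => (1 + ‖p‖) ^ (-(3 : ℝ))) :=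
    integrable_one_add_norm (by simp; norm_num)
  refine Integrable.mono' (h.const_mul ((1 / R + 1) ^ 3)).integrableOn
    (((measurable_planeDist 0).pow_const 3).inv.aestronglyMeasurable) ?_
  refine (ae_restrict_iff' (measurableSet_groundSet R)).2
    (Filter.Eventually.of_forall fun p hp => ?_)
  have h1 := le_planeDist_zero hp
  have h2 : ‖p‖ ≤ planeDist 0 p := by
    rw [Prod.norm_def, Real.norm_eq_abs, Real.norm_eq_abs]
    refine max_le ?_ ?_ <;> refine abs_le_of_sq_le_sq ?_ (planeDist_nonneg _ _) <;>
      rw [planeDist_zero_sq] <;> nlinarith [sq_nonneg p.1, sq_nonneg p.2]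
  have h3 : 0 < planeDist 0 p := hR.trans_le h1
  have h4 : 1 + ‖p‖ ≤ (1 / R + 1) * planeDist 0 p := by
    have : 1 ≤ 1 / R * planeDist 0 p := by rw [one_div, ← div_eq_inv_mul, one_le_div hR]; exact h1
    linarith
  rw [Real.rpow_neg (by positivity), show (3 : ℝ) = ((3 : ℕ) : ℝ) by norm_num, Real.rpow_natCast,
    Real.norm_of_nonneg (by positivity), ← div_eq_mul_inv, le_div_iff₀ (by positivity),
    inv_mul_le_iff₀ (by positivity), ← mul_pow, mul_comm]
  gcongr

lemma measurable_kernelForm (y x : E3) : Measurable (kernelForm y x) := by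
  have h1 := measurable_planeDist x
  have h2 := measurable_planeDist y
  unfold kernelForm
  fun_prop

lemma integrableOn_kernelForm {R : ℝ} (hR : 0 < R) {y x : E3} (hy : ‖y‖ < R) (hx : ‖x‖ < R) :
    IntegrableOn (kernelForm y x) (groundSet R) := by
  have hκ : ∀ v : E3, ‖v‖ < R → 0 < 1 - ‖v‖ / R := fun v hv => by
    rw [sub_pos, div_lt_one hR]; exact hv
  refine Integrable.mono' ((integrableOn_planeDist_inv hR).const_mul
    (‖-y 2 / (8 * Real.pi ^ 2)‖ * (((1 - ‖x‖ / R) * R)⁻¹ * (((1 - ‖y‖ / R)) ^ 3)⁻¹)))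
    (measurable_kernelForm y x).aestronglyMeasurable ?_
  refine (ae_restrict_iff' (measurableSet_groundSet R)).2
    (Filter.Eventually.of_forall fun p hp => ?_)
  have h1 := le_planeDist_zero hp
  have h3 : 0 < planeDist 0 p := hR.trans_le h1
  have hxp := planeDist_pos hx hp
  have hyp := planeDist_pos hy hp
  rw [kernelForm, norm_mul, mul_assoc]
  refine mul_le_mul_of_nonneg_left ?_ (norm_nonneg _)
  rw [Real.norm_of_nonneg (by positivity), mul_assoc, ← mul_inv, ← mul_inv, ← mul_inv]
  have hkx := hκ x hx
  have hky := hκ y hy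
  refine inv_anti₀ (by positivity) ?_
  have h5 := planeDist_ge (v := x) hR hp
  have h6 := planeDist_ge (v := y) hR hp
  calc (1 - ‖x‖ / R) * R * ((1 - ‖y‖ / R) ^ 3 * planeDist 0 p ^ 3)
      ≤ ((1 - ‖x‖ / R) * planeDist 0 p) * (((1 - ‖y‖ / R) * planeDist 0 p) ^ 3) := by
        rw [mul_pow]; gcongr
    _ ≤ _ := by gcongr

lemma measurable_singS_plane (n : ℕ) (m : ℤ) :
    Measurable fun p : ℝ × ℝ => singS n m (planePoint p 0) := by
  have h0 : ∀ p, ‖planePoint p 0‖ = planeDist 0 p := fun p => by rw [planeDist, sub_zero]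
  have h1 : ∀ p, polarAngle (planePoint p 0) = Real.pi / 2 := fun p => by
    simp [polarAngle, planePoint]
  have h2 : ∀ p, azimuth (planePoint p 0) = Complex.arg ⟨p.1, p.2⟩ := fun p => by
    simp [azimuth, planePoint]
  have h3 : Measurable fun p : ℝ × ℝ => Complex.arg ⟨p.1, p.2⟩ :=
    Complex.measurable_arg.comp Complex.measurableEquivRealProd.symm.measurable
  have h4 := measurable_planeDist 0
  simp only [singS, h0, h1, h2, sphY_equator]
  fun_prop

lemma measurable_productTerm (y x : E3) (q : (ℕ × ℤ) × (ℕ × ℤ)) :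
    Measurable (productTerm y x q) :=
  ((measurable_singS_plane _ _).mul (measurable_singS_plane _ _)).const_mul _

lemma integrableOn_productTerm {R : ℝ} (hR : 0 < R) (y x : E3) (q : (ℕ × ℤ) × (ℕ × ℤ)) :
    IntegrableOn (productTerm y x q) (groundSet R) := by
  refine Integrable.mono' ((integrableOn_planeDist_inv hR).const_mul (productBound R y x q))
    (measurable_productTerm y x q).aestronglyMeasurable ?_
  exact (ae_restrict_iff' (measurableSet_groundSet R)).2
    (Filter.Eventually.of_forall fun p hp => norm_productTerm_le y x q hR hp)

lemma integrableOn_kernelIntegrand {R : ℝ} (hR : 0 < R) {y x : E3} (hy : ‖y‖ < R) (hx : ‖x‖ < R) :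
    IntegrableOn (kernelIntegrand y x) (groundSet R) :=
  (integrableOn_kernelForm hR hy hx).congr_fun (fun _ hp => (kernelIntegrand_eq hy x hp).symm)
    (measurableSet_groundSet R)

lemma kernelD_eq {R : ℝ} {y : E3} (hy : ‖y‖ < R) (x : E3) :
    kernelD R y x = ∫ p in groundSet R, kernelForm y x p :=
  setIntegral_congr_fun (measurableSet_groundSet R) fun _ hp => kernelIntegrand_eq hy x hp

/-- Termwise integration of the fourfold series. -/
lemma hasSum_integral_productTerm {R : ℝ} (hR : 0 < R) {y x : E3} (hy : ‖y‖ < R) (hx : ‖x‖ < R) :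
    HasSum (fun q => ∫ p in groundSet R, productTerm y x q p) (kernelD R y x : ℂ) := by
  have hs : Summable fun q => ∫ p in groundSet R, ‖productTerm y x q p‖ := by
    refine Summable.of_nonneg_of_le (fun q => integral_nonneg fun p => norm_nonneg _) (fun q => ?_)
      ((summable_productBound hR hy hx).mul_right (∫ p in groundSet R, (planeDist 0 p ^ 3)⁻¹))
    rw [← integral_const_mul]
    exact setIntegral_mono_on (integrableOn_productTerm hR y x q).norm
      ((integrableOn_planeDist_inv hR).const_mul _) (measurableSet_groundSet R)
      fun p hp => norm_productTerm_le y x q hR hp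
  have h := hasSum_integral_of_summable_integral_norm
    (fun q => integrableOn_productTerm hR y x q) hs
  refine h.of_eq (fun _ => rfl) ?_
  rw [kernelD_eq hy, ← integral_complex_ofReal]
  exact setIntegral_congr_fun (measurableSet_groundSet R)
    fun p hp => (hasSum_productTerm hR hy hx hp).tsum_eq.symm

/-- Integration over the exterior of a disc, in polar coordinates `φ` and `η = R / s`. -/
lemma integral_groundSet {R : ℝ} (hR : 0 < R) {E : Type*} [NormedAddCommGroup E]
    [NormedSpace ℝ E] {f : ℝ × ℝ → E} (hf : StronglyMeasurable f)
    (hi : IntegrableOn f (groundSet R)) :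
    ∫ p in groundSet R, f p = ∫ φ in (0 : ℝ)..(2 * Real.pi), ∫ η in (0 : ℝ)..1,
      (R ^ 2 / η ^ 3) • f (polarPt (R / η) φ) := by
  set g : ℝ × ℝ → E := (groundSet R).indicator f with hg
  have hgm : StronglyMeasurable g := hf.indicator (measurableSet_groundSet R)
  have hgi : Integrable g := (integrable_indicator_iff (measurableSet_groundSet R)).2 hi
  set F : ℝ × ℝ → E := fun p => p.1 • g (polarCoord.symm p) with hF
  have hFm : StronglyMeasurable F :=
    measurable_fst.stronglyMeasurable.smul
      (hgm.comp_measurable continuous_polarCoord_symm.measurable)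
  have hFi : IntegrableOn F (Set.Ioi 0 ×ˢ Set.Ioo (-Real.pi) Real.pi) := by
    refine ⟨hFm.aestronglyMeasurable, ?_⟩
    have h := lintegral_comp_polarCoord_symm fun p => ‖g p‖ₑ
    rw [hasFiniteIntegral_iff_enorm]
    refine lt_of_eq_of_lt ?_ (lt_of_eq_of_lt h hgi.hasFiniteIntegral)
    refine setLIntegral_congr_fun (measurableSet_Ioi.prod measurableSet_Ioo) fun p hp => ?_
    have hp1 : 0 < p.1 := hp.1
    simp only [hF, enorm_smul, smul_eq_mul, Real.enorm_eq_ofReal hp1.le]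
  rw [← integral_indicator (measurableSet_groundSet R), ← integral_comp_polarCoord_symm]
  change ∫ p in Set.Ioi 0 ×ˢ Set.Ioo (-Real.pi) Real.pi, F p = _
  rw [Measure.volume_eq_prod, ← Measure.prod_restrict, integral_prod_symm _ (by
    rwa [IntegrableOn, Measure.volume_eq_prod, ← Measure.prod_restrict] at hFi)]
  have hinner : ∀ φ : ℝ, ∫ r in Set.Ioi 0, F (r, φ) = ∫ η in (0 : ℝ)..1,
      (R ^ 2 / η ^ 3) • f (polarPt (R / η) φ) := by
    intro φ
    have h1 := integral_comp_mul_left_Ioi' (fun r => F (r, φ)) 0 hR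
    rw [mul_zero] at h1
    rw [← h1, ← integral_comp_rpow_Ioi (fun r => F (R * r, φ)) (p := -1) (by norm_num),
      ← integral_smul, intervalIntegral.integral_of_le zero_le_one,
      ← Set.Ioi_inter_Iic, ← setIntegral_indicator measurableSet_Iic]
    refine setIntegral_congr_fun measurableSet_Ioi fun η hη => ?_
    have hη : 0 < η := hη
    have e : g (polarCoord.symm (R * η ^ (-1 : ℝ), φ)) = (Set.Iic (1 : ℝ)).indicator
        (fun η => f (polarPt (R / η) φ)) η := by
      have hpt : polarCoord.symm (R * η ^ (-1 : ℝ), φ) = polarPt (R / η) φ := by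
        rw [Real.rpow_neg_one, ← div_eq_mul_inv]; rfl
      have hmem : polarPt (R / η) φ ∈ groundSet R ↔ η ∈ Set.Iic (1 : ℝ) := by
        change R ^ 2 ≤ (polarPt (R / η) φ).1 ^ 2 + (polarPt (R / η) φ).2 ^ 2 ↔ _
        rw [← planeDist_zero_sq, planeDist_zero_polarPt (by positivity), Set.mem_Iic,
          pow_le_pow_iff_left₀ hR.le (by positivity) two_ne_zero, le_div_iff₀ hη]
        exact mul_le_iff_le_one_right hR
      rw [hpt, hg]
      by_cases h : η ∈ Set.Iic (1 : ℝ)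
      · rw [Set.indicator_of_mem h, Set.indicator_of_mem (hmem.2 h)]
      · rw [Set.indicator_of_notMem h, Set.indicator_of_notMem (fun h' => h (hmem.1 h'))]
    simp only [hF, e, ← Set.indicator_const_smul_apply]
    by_cases h : η ∈ Set.Iic (1 : ℝ)
    · rw [Set.indicator_of_mem h, Set.indicator_of_mem h, smul_smul, smul_smul]
      congr 1
      rw [show (-1 - 1 : ℝ) = ((-2 : ℤ) : ℝ) by norm_num, Real.rpow_intCast, Real.rpow_neg_one]
      simp only [abs_neg, abs_one, one_mul]
      field_simp
    · rw [Set.indicator_of_notMem h, Set.indicator_of_notMem h]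
  simp only [hinner]
  set H : ℝ → E := fun φ => ∫ η in (0 : ℝ)..1,
      (R ^ 2 / η ^ 3) • f (polarPt (R / η) φ) with hH
  have hper : Function.Periodic H (2 * Real.pi) := fun φ => by simp [hH, polarPt]
  rw [← integral_Ioc_eq_integral_Ioo, ← intervalIntegral.integral_of_le (by linarith [Real.pi_pos])]
  have := hper.intervalIntegral_add_eq (-Real.pi) 0
  rw [zero_add, show -Real.pi + 2 * Real.pi = Real.pi by ring] at this
  exact this

/-- The dimensionless kernel is the kernel for `R`, rescaled. -/
lemma kernelD_eq_kernelTilde {R : ℝ} (hR : 0 < R) {y x : E3} (hy : ‖y‖ < R) (hx : ‖x‖ < R) :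
    kernelD R y x = 1 / R * kernelTilde (R⁻¹ • y) (R⁻¹ • x) := by
  -- `Q` is the distance to the ground point in units of its distance `R / η` to the origin
  have hQ : ∀ (v : E3) (η φ : ℝ), 0 < η →
      kernelQ η (φ - azimuth (R⁻¹ • v)) (rho (R⁻¹ • v)) ‖R⁻¹ • v‖ 1 =
      planeDist v (polarPt (R / η) φ) * (η / R) := by
    intro v η φ hη
    have h1 : ∀ u : E3, rho u * Real.cos (φ - azimuth u) =
        u 0 * Real.cos φ + u 1 * Real.sin φ := by
      intro u
      have hu := horiz_eq u
      have h0 := congrArg Complex.re hu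
      have h1 := congrArg Complex.im hu
      simp only [horiz, Complex.exp_mul_I, Complex.mul_re, Complex.mul_im, Complex.add_re,
        Complex.add_im, Complex.ofReal_re, Complex.ofReal_im, ← Complex.ofReal_cos,
        ← Complex.ofReal_sin, Complex.I_re, Complex.I_im] at h0 h1
      rw [h0, h1, Real.cos_sub]; ring
    rw [← Real.sqrt_sq (mul_nonneg (planeDist_nonneg v (polarPt (R / η) φ))
      (by positivity : 0 ≤ η / R)), kernelQ]
    congr 1
    have h2 := h1 (R⁻¹ • v)
    simp only [PiLp.smul_apply, smul_eq_mul] at h2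
    rw [mul_pow, planeDist_sq, polarPt, norm_smul, mul_pow, norm_sq_E3,
      Real.norm_of_nonneg (by positivity)]
    have h3 : ((R / η * Real.cos φ - v 0) ^ 2 + (R / η * Real.sin φ - v 1) ^ 2 + v 2 ^ 2) *
        (η / R) ^ 2 = (Real.cos φ - η * (R⁻¹ * v 0)) ^ 2 + (Real.sin φ - η * (R⁻¹ * v 1)) ^ 2 +
        (η * (R⁻¹ * v 2)) ^ 2 := by field_simp
    rw [h3]
    linear_combination (-2 * η) * h2 - Real.sin_sq_add_cos_sq φ
  rw [kernelD_eq hy, integral_groundSet hR (measurable_kernelForm y x).stronglyMeasurable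
      (integrableOn_kernelForm hR hy hx), kernelTilde, ← mul_assoc,
    ← intervalIntegral.integral_const_mul]
  refine intervalIntegral.integral_congr fun φ _ => ?_
  dsimp only
  rw [← intervalIntegral.integral_const_mul, intervalIntegral.integral_of_le zero_le_one,
    intervalIntegral.integral_of_le zero_le_one]
  refine setIntegral_congr_fun measurableSet_Ioc fun η hη => ?_
  have hη0 : 0 < η := hη.1
  have hmem : polarPt (R / η) φ ∈ groundSet R := by
    change R ^ 2 ≤ (polarPt (R / η) φ).1 ^ 2 + (polarPt (R / η) φ).2 ^ 2
    rw [← planeDist_zero_sq, planeDist_zero_polarPt (by positivity)]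
    have : R ≤ R / η := by rw [le_div_iff₀ hη0]; exact mul_le_of_le_one_right hR.le hη.2
    gcongr
  have hxp := planeDist_pos hx hmem
  have hyp := planeDist_pos hy hmem
  simp only [hQ _ _ _ hη0, kernelForm, PiLp.smul_apply, smul_eq_mul]
  field_simp

lemma integrableOn_singS_mul {R : ℝ} (hR : 0 < R) (n n' : ℕ) (m m' : ℤ) :
    IntegrableOn (fun p : ℝ × ℝ =>
      singS (n' + 1) m' (planePoint p 0) * singS n m (planePoint p 0)) (groundSet R) := by
  refine Integrable.mono' ((integrableOn_planeDist_inv hR).const_mul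
    (|coefL (n' + 1) m'| * |coefL n m| * (R ^ (n' + n))⁻¹))
    ((measurable_singS_plane _ _).mul (measurable_singS_plane _ _)).aestronglyMeasurable ?_
  refine (ae_restrict_iff' (measurableSet_groundSet R)).2
    (Filter.Eventually.of_forall fun p hp => ?_)
  have hs := le_planeDist_zero hp
  obtain ⟨φ, hφ⟩ := exists_polarPt p
  generalize planeDist 0 p = s at *
  have hs0 : 0 < s := hR.trans_le hs
  rw [hφ, singS_polarPt _ _ hs0, singS_polarPt _ _ hs0, norm_mul, norm_mul, norm_mul, norm_mul,
    norm_mul, norm_exp_int, norm_exp_int, mul_one, mul_one, Complex.norm_real, Complex.norm_real,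
    Complex.norm_real, Complex.norm_real,
    Real.norm_of_nonneg (by positivity : 0 ≤ (s ^ (n' + 1 + 1))⁻¹),
    Real.norm_of_nonneg (by positivity : 0 ≤ (s ^ (n + 1))⁻¹), Real.norm_eq_abs, Real.norm_eq_abs]
  calc _ = |coefL (n' + 1) m'| * |coefL n m| * (s ^ (n' + n))⁻¹ * (s ^ 3)⁻¹ := by
        field_simp; ring
    _ ≤ _ := by gcongr

/-- The surface integrals of products of singular solid harmonics. -/
lemma integral_singS_mul {R : ℝ} (hR : 0 < R) (n n' : ℕ) (m m' : ℤ) :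
    ∫ p in groundSet R, singS (n' + 1) m' (planePoint p 0) * singS n m (planePoint p 0) =
      if m' = -m then ((2 * Real.pi * coefL (n' + 1) m * coefL n m /
        ((n' : ℝ) + n + 1) * (R ^ (n' + n + 1))⁻¹ : ℝ) : ℂ) else 0 := by
  have hm : StronglyMeasurable fun p : ℝ × ℝ =>
      singS (n' + 1) m' (planePoint p 0) * singS n m (planePoint p 0) :=
    ((measurable_singS_plane _ _).mul (measurable_singS_plane _ _)).stronglyMeasurable
  rw [integral_groundSet hR hm (integrableOn_singS_mul hR n n' m m')]
  have h1 : ∀ φ : ℝ, ∫ η in (0 : ℝ)..1, (R ^ 2 / η ^ 3) •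
      (singS (n' + 1) m' (planePoint (polarPt (R / η) φ) 0) *
        singS n m (planePoint (polarPt (R / η) φ) 0)) =
      ((coefL (n' + 1) m' * coefL n m / ((n' : ℝ) + n + 1) * (R ^ (n' + n + 1))⁻¹ : ℝ) : ℂ) *
        Complex.exp (Complex.I * (m' + m : ℤ) * φ) := by
    intro φ
    have h2 : ∫ η in (0 : ℝ)..1, (R ^ 2 / η ^ 3) •
      (singS (n' + 1) m' (planePoint (polarPt (R / η) φ) 0) *
        singS n m (planePoint (polarPt (R / η) φ) 0)) =
        ∫ η in (0 : ℝ)..1, ((η ^ (n' + n) : ℝ) : ℂ) *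
          (((coefL (n' + 1) m' * coefL n m * (R ^ (n' + n + 1))⁻¹ : ℝ) : ℂ) *
        Complex.exp (Complex.I * (m' + m : ℤ) * φ)) := by
      rw [intervalIntegral.integral_of_le zero_le_one, intervalIntegral.integral_of_le zero_le_one]
      refine setIntegral_congr_fun measurableSet_Ioc fun η hη => ?_
      have hη0 : 0 < η := hη.1
      have he : Complex.exp (Complex.I * (m' + m : ℤ) * φ) =
          Complex.exp (Complex.I * m' * φ) * Complex.exp (Complex.I * m * φ) := by
        rw [← Complex.exp_add]; congr 1; push_cast; ring
      have hc : R ^ 2 / η ^ 3 * (((R / η) ^ (n' + 1 + 1))⁻¹ * ((R / η) ^ (n + 1))⁻¹) =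
          η ^ (n' + n) * (R ^ (n' + n + 1))⁻¹ := by
        rw [div_pow, div_pow]
        field_simp
        ring
      rw [singS_polarPt _ _ (by positivity), singS_polarPt _ _ (by positivity), he,
        Complex.real_smul]
      have hc' := congrArg (fun r : ℝ => (r : ℂ)) hc
      push_cast at hc' ⊢
      linear_combination (coefL (n' + 1) m' * coefL n m * (Complex.exp (Complex.I * m' * φ) *
        Complex.exp (Complex.I * m * φ)) : ℂ) * hc'
    rw [h2, intervalIntegral.integral_mul_const, intervalIntegral.integral_ofReal, integral_pow]
    push_cast
    simp
    ring
  simp only [h1]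
  rw [intervalIntegral.integral_const_mul, integral_exp_int]
  by_cases h : m' = -m
  · rw [if_pos (by omega), if_pos h, h, coefL_neg]
    push_cast; ring
  · rw [if_neg (by omega), if_neg h]; simp

/-! ### The series for the kernel -/

/-- Summands of the fourfold series, `q = ((n, m), (n', m'))`. -/
noncomputable def kernelTerm (R : ℝ) (y x : E3) (q : (ℕ × ℤ) × (ℕ × ℤ)) : ℂ :=
  ((2 * coefA q.2.1 q.2.2 / (2 * (q.1.1 : ℝ) + 1) : ℝ) : ℂ) * regR q.1.1 (-q.1.2) x *
    regR q.2.1 (-q.2.2) y *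
    ∫ p in groundSet R, singS (q.2.1 + 1) q.2.2 (planePoint p 0) *
      singS q.1.1 q.1.2 (planePoint p 0)

lemma hasSum_kernelTerm {R : ℝ} (hR : 0 < R) {y x : E3} (hy : ‖y‖ < R) (hx : ‖x‖ < R) :
    HasSum (kernelTerm R y x) (kernelD R y x : ℂ) := by
  refine (hasSum_integral_productTerm hR hy hx).of_eq (fun q => ?_) rfl
  simp only [productTerm]
  rw [integral_const_mul, kernelTerm]

lemma kernelTerm_eq {R : ℝ} (hR : 0 < R) (y x : E3) (n n' : ℕ) (m m' : ℤ) :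
    kernelTerm R y x ((n, m), (n', m')) =
      if m' = -m then (coefI R m n' n : ℂ) * regR n (-m) x * regR n' m y else 0 := by
  simp only [kernelTerm]
  rw [integral_singS_mul hR]
  split_ifs with h
  · rw [h, neg_neg, coefA_neg, coefI, coefJ]
    push_cast
    field_simp
    ring
  · rw [mul_zero]

lemma kernelTerm_of_lt_left (R : ℝ) (y x : E3) {n : ℕ} {m : ℤ} (h : n < m.natAbs) (q : ℕ × ℤ) :
    kernelTerm R y x ((n, m), q) = 0 := by
  simp only [kernelTerm]
  rw [regR_of_lt (m := -m) (by simpa using h)]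
  simp

lemma kernelTerm_of_lt_right (R : ℝ) (y x : E3) {n : ℕ} {m : ℤ} (h : n < m.natAbs) (q : ℕ × ℤ) :
    kernelTerm R y x (q, (n, m)) = 0 := by
  simp only [kernelTerm]
  rw [regR_of_lt (m := -m) (by simpa using h)]
  simp

lemma hasSum_sum_Icc {f : ℕ × ℤ → ℂ} {a : ℂ} (h : HasSum f a)
    (h0 : ∀ (n : ℕ) (m : ℤ), n < m.natAbs → f (n, m) = 0) :
    HasSum (fun n : ℕ => ∑ m ∈ Finset.Icc (-(n : ℤ)) n, f (n, m)) a := by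
  refine h.prod_fiberwise fun n => hasSum_sum_of_ne_finset_zero fun m hm => h0 n m ?_
  rw [Finset.mem_Icc] at hm
  omega

lemma hasSum_kernelTerm_inner {R : ℝ} (hR : 0 < R) {y x : E3} (hy : ‖y‖ < R) (hx : ‖x‖ < R)
    (p : ℕ × ℤ) : HasSum (fun n' : ℕ => ∑ m' ∈ Finset.Icc (-(n' : ℤ)) n',
      kernelTerm R y x (p, (n', m'))) (∑' r, kernelTerm R y x (p, r)) :=
  hasSum_sum_Icc (f := fun r => kernelTerm R y x (p, r))
    ((hasSum_kernelTerm hR hy hx).summable.prod_factor p).hasSum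
    fun _ _ h => kernelTerm_of_lt_right R y x h p

lemma hasSum_kernelTerm_iterated {R : ℝ} (hR : 0 < R) {y x : E3} (hy : ‖y‖ < R) (hx : ‖x‖ < R) :
    HasSum (fun n : ℕ => ∑ m ∈ Finset.Icc (-(n : ℤ)) n, ∑' n' : ℕ,
      ∑ m' ∈ Finset.Icc (-(n' : ℤ)) n', kernelTerm R y x ((n, m), (n', m')))
      (kernelD R y x : ℂ) := by
  have h := (hasSum_kernelTerm hR hy hx).prod_fiberwise
    fun p => ((hasSum_kernelTerm hR hy hx).summable.prod_factor p).hasSum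
  refine (hasSum_sum_Icc h fun n m hnm => ?_).of_eq (fun n => ?_) rfl
  · simp [kernelTerm_of_lt_left R y x hnm]
  · exact Finset.sum_congr rfl fun m _ => (hasSum_kernelTerm_inner hR hy hx (n, m)).tsum_eq

/-- Only `m' = -m` contributes to the fourfold series. -/
lemma sum_kernelTerm {R : ℝ} (hR : 0 < R) (y x : E3) (n n' : ℕ) (m : ℤ) :
    ∑ m' ∈ Finset.Icc (-(n' : ℤ)) n', kernelTerm R y x ((n, m), (n', m')) =
      (coefI R m n' n : ℂ) * regR n (-m) x * regR n' m y := by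
  simp only [kernelTerm_eq hR, Finset.sum_ite_eq']
  split_ifs with h
  · rfl
  · rw [regR_of_lt (n := n') (m := m), mul_zero]
    rw [Finset.mem_Icc] at h
    omega

lemma parityL_of_odd {n : ℕ} {m : ℤ} (h : ((n : ℤ) + m) % 2 = 1) : parityL n m = 0 := by
  rw [parityL, if_neg]
  rw [Int.even_iff]; omega

lemma parityL_of_even {n : ℕ} {m : ℤ} (h : ((n : ℤ) + m) % 2 = 0) : parityL n m = 1 := by
  rw [parityL, if_pos]
  rwa [Int.even_iff]

/-- The factor `L_{|m|+1}^m` vanishes because `|m| + 1 + m` is odd. -/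
lemma coefI_natAbs (R : ℝ) (m : ℤ) (n' : ℕ) : coefI R m m.natAbs n' = 0 := by
  have : coefL (m.natAbs + 1) m = 0 := by
    rw [coefL_eq (Nat.le_succ _), parityL_of_odd (by omega)]
    ring
  rw [coefI, coefJ, this]
  simp

/-- The nonzero terms of the fourfold series have `m' = -m`, `n ≥ |m|` and `n' ≥ |m| + 1`, so the
triple series is a reindexing of it. -/
lemma hasSum_triple {R : ℝ} (hR : 0 < R) {y x : E3} (hy : ‖y‖ < R) (hx : ‖x‖ < R) :
    HasSum (fun q : ℤ × ℕ × ℕ =>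
        (coefI R q.1 (q.1.natAbs + 1 + q.2.1) (q.1.natAbs + q.2.2) : ℂ) *
          regR (q.1.natAbs + q.2.2) (-q.1) x * regR (q.1.natAbs + 1 + q.2.1) q.1 y)
        (kernelD R y x : ℂ) := by
  let i : ℤ × ℕ × ℕ → (ℕ × ℤ) × (ℕ × ℤ) := fun q =>
    ((q.1.natAbs + q.2.2, q.1), (q.1.natAbs + 1 + q.2.1, -q.1))
  have hi : Function.Injective i := by
    rintro ⟨m, k, k'⟩ ⟨m1, k1, k1'⟩ h
    simp only [i, Prod.mk.injEq] at h
    obtain ⟨⟨h1, rfl⟩, h2, -⟩ := h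
    simp only [Prod.mk.injEq, true_and]
    omega
  have h := (hi.hasSum_iff (f := kernelTerm R y x) (a := (kernelD R y x : ℂ)) ?_).2
    (hasSum_kernelTerm hR hy hx)
  · refine h.of_eq (fun q => ?_) rfl
    simp only [Function.comp, i]
    rw [kernelTerm_eq hR, if_pos rfl]
  · -- all other terms of the fourfold series are zero
    rintro ⟨⟨n, m⟩, ⟨n', m'⟩⟩ hq
    rw [kernelTerm_eq hR]
    split_ifs with hm
    · subst hm
      rcases lt_or_ge n m.natAbs with h1 | h1
      · rw [regR_of_lt (m := -m) (by simpa using h1)]; simp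
      rcases lt_trichotomy n' m.natAbs with h2 | h2 | h2
      · rw [regR_of_lt h2, mul_zero]
      · rw [h2, coefI_natAbs]; simp
      · refine absurd ⟨(m, n' - (m.natAbs + 1), n - m.natAbs), ?_⟩ hq
        simp only [i, Prod.mk.injEq, and_true]
        omega
    · rfl

/-! ### The dimensionless kernel -/

lemma kernelTilde_eq {y x : E3} (hy : ‖y‖ < 1) (hx : ‖x‖ < 1) :
    kernelTilde y x = kernelD 1 y x := by
  rw [kernelD_eq_kernelTilde one_pos hy hx]; simp

lemma coefI_one (m : ℤ) (n n' : ℕ) : coefI 1 m n n' = coefJ m n n' := by simp [coefI]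

/-- Summands of the series over `n' = |m| + k` in the coefficients of degree `n` and order `m`. -/
noncomputable def radialTerm (n : ℕ) (m : ℤ) (x : E3) (k : ℕ) : ℝ :=
  coefNu (m.natAbs + k) m / (((m.natAbs + k : ℕ) : ℝ) + n + 1) *
    solidPolar (m.natAbs + k) m.natAbs x

lemma norm_fourierC (ε n : ℕ) (m : ℤ) (v : E3) :
    ‖fourierC ε n m v‖ = |coefNu (n + ε) m * solidPolar n m.natAbs v| := by
  rw [fourierC, solidH, norm_mul, norm_mul, norm_exp_int, mul_one, Complex.norm_real,
    Complex.norm_real, Int.natAbs_neg, abs_mul, Real.norm_eq_abs, Real.norm_eq_abs]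

lemma summable_radialTerm (n : ℕ) (m : ℤ) {x : E3} (hx : ‖x‖ < 1) :
    Summable (radialTerm n m x) := by
  have hi : Function.Injective fun k : ℕ => (m.natAbs + k, m) := fun a b h => by
    simpa using h
  refine Summable.of_norm_bounded ((summable_majorant (norm_nonneg x) hx).comp_injective hi)
    fun k => ?_
  refine le_trans ?_ (norm_fourierC_le (Or.inl rfl) (m.natAbs + k) m x)
  rw [norm_fourierC, radialTerm, add_zero, div_mul_eq_mul_div, Real.norm_eq_abs, abs_div]
  refine div_le_self (abs_nonneg _) ?_
  rw [abs_of_pos (by positivity)]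
  have : (0 : ℝ) ≤ ((m.natAbs + k : ℕ) : ℝ) + n := by positivity
  linarith

lemma termU_eq (n : ℕ) (m : ℤ) (x : E3) (k : ℕ) : termU n m x k =
    ((coefA n m * coefL (n + 1) m : ℝ) : ℂ) *
      Complex.exp (Complex.I * (-m : ℤ) * azimuth x) * (radialTerm n m x k : ℂ) := by
  have h := coefL_mul_regR (m.natAbs + k) m x
  rw [solidH, Int.natAbs_neg] at h
  have h1 : ((m.natAbs + k : ℕ) : ℂ) + n + 1 ≠ 0 := by
    exact_mod_cast Nat.succ_ne_zero (m.natAbs + k + n)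
  have h2 : 2 * ((m.natAbs + k : ℕ) : ℂ) + 1 ≠ 0 := by
    exact_mod_cast Nat.succ_ne_zero (2 * (m.natAbs + k))
  have e : termU n m x k = ((coefA n m * coefL (n + 1) m : ℝ) : ℂ) *
      ((((m.natAbs + k : ℕ) : ℂ) + n + 1)⁻¹ *
      (((4 * Real.pi / (2 * (m.natAbs + k : ℕ) + 1) * coefL (m.natAbs + k) m : ℝ) : ℂ) *
        regR (m.natAbs + k) (-m) x)) := by
    rw [termU, coefJ]
    generalize m.natAbs + k = N at *
    have h3 : (n : ℂ) + N + 1 ≠ 0 := by rwa [add_comm (n : ℂ)]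
    push_cast
    field_simp
    ring
  rw [e, h, radialTerm]
  generalize m.natAbs + k = N at *
  push_cast
  ring

lemma summable_termU (n : ℕ) (m : ℤ) {x : E3} (hx : ‖x‖ < 1) : Summable (termU n m x) := by
  simp only [funext (termU_eq n m x)]
  exact (Complex.hasSum_ofReal.2 (summable_radialTerm n m hx).hasSum).summable.mul_left _

/-- Here the degree and order of `y` are summed last, so the fourfold series is reindexed by them
and by `k = n - |m|`, where `n` is the degree in `x`. -/
lemma hasSum_coefU {y x : E3} (hy : ‖y‖ < 1) (hx : ‖x‖ < 1) :
    HasSum (fun n : ℕ => ∑ m ∈ Finset.Icc (-(n : ℤ)) n, coefU n m x * regR n m y)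
      (kernelTilde y x : ℂ) := by
  let i : (ℕ × ℤ) × ℕ → (ℕ × ℤ) × (ℕ × ℤ) := fun q =>
    ((q.1.2.natAbs + q.2, q.1.2), (q.1.1, -q.1.2))
  have hi : Function.Injective i := by
    rintro ⟨⟨n, m⟩, k⟩ ⟨⟨n1, m1⟩, k1⟩ h
    simp only [i, Prod.mk.injEq] at h
    obtain ⟨⟨h1, rfl⟩, rfl, -⟩ := h
    simp only [Prod.mk.injEq, true_and]
    omega
  have h := (hi.hasSum_iff (f := kernelTerm 1 y x) (a := (kernelD 1 y x : ℂ)) ?_).2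
    (hasSum_kernelTerm one_pos hy hx)
  · have h1 : HasSum (fun q : (ℕ × ℤ) × ℕ => termU q.1.1 q.1.2 x q.2 * regR q.1.1 q.1.2 y)
        (kernelTilde y x : ℂ) := by
      rw [kernelTilde_eq hy hx]
      refine h.of_eq (fun q => ?_) rfl
      simp only [Function.comp, i]
      rw [kernelTerm_eq one_pos, if_pos rfl, coefI_one, termU]
    have h2 : ∀ p : ℕ × ℤ, HasSum (fun k => termU p.1 p.2 x k * regR p.1 p.2 y)
        (coefU p.1 p.2 x * regR p.1 p.2 y) := fun p =>
      (summable_termU p.1 p.2 hx).hasSum.mul_right (regR p.1 p.2 y)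
    refine hasSum_sum_Icc (f := fun p => coefU p.1 p.2 x * regR p.1 p.2 y)
      (h1.prod_fiberwise h2) fun n m hnm => ?_
    rw [regR_of_lt hnm, mul_zero]
  · -- all other terms of the fourfold series are zero
    rintro ⟨⟨n, m⟩, ⟨n', m'⟩⟩ hq
    rw [kernelTerm_eq one_pos]
    split_ifs with hm
    · subst hm
      rcases lt_or_ge n m.natAbs with h1 | h1
      · rw [regR_of_lt (m := -m) (by simpa using h1)]; simp
      · refine absurd ⟨((n', m), n - m.natAbs), ?_⟩ hq
        simp only [i, Prod.mk.injEq, and_true]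
        omega
    · rfl

/-! ### Real form -/

/-- The part of the terms of degree `n` and order `±m` that does not depend on the azimuths. -/
noncomputable def radialProduct (n : ℕ) (m : ℤ) (y x : E3) : ℝ :=
  1 / (4 * Real.pi) * coefNu (n + 1) m * (∑' k, radialTerm n m x k) * solidPolar n m.natAbs y

lemma radialProduct_neg (n : ℕ) (m : ℤ) (y x : E3) :
    radialProduct n (-m) y x = radialProduct n m y x := by
  simp [radialProduct, radialTerm, coefNu_neg]

lemma coefU_mul_regR (n : ℕ) (m : ℤ) (y x : E3) : coefU n m x * regR n m y =
    radialProduct n m y x * Complex.exp (Complex.I * m * (azimuth y - azimuth x : ℝ)) := by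
  have h := coefA_mul_coefL_mul_regR n (-m) y
  rw [neg_neg, coefA_neg, coefL_neg, coefNu_neg, solidH] at h
  have hπ : (Real.pi : ℂ) ≠ 0 := by exact_mod_cast Real.pi_ne_zero
  have he : Complex.exp (Complex.I * m * (azimuth y - azimuth x : ℝ)) =
      Complex.exp (Complex.I * (-m : ℤ) * azimuth x) * Complex.exp (Complex.I * m * azimuth y) := by
    rw [← Complex.exp_add]; congr 1; push_cast; ring
  rw [coefU, funext (termU_eq n m x), tsum_mul_left, ← Complex.ofReal_tsum, he, radialProduct]
  generalize ∑' k, radialTerm n m x k = S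
  generalize Complex.exp (Complex.I * (-m : ℤ) * azimuth x) = E
  have hπ' : 1 / (4 * (Real.pi : ℂ)) * (4 * Real.pi) = 1 := by field_simp
  push_cast at h ⊢
  linear_combination (E * S * (1 / (4 * (Real.pi : ℂ)))) * h -
    (coefA n m * coefL (n + 1) m * regR n m y * E * S) * hπ'

/-- The azimuthal factor of the real solid harmonics. -/
noncomputable def trigFactor (m : ℤ) (φ : ℝ) : ℝ :=
  if 0 ≤ m then Real.cos (m * φ) else Real.sin (m * φ)

lemma realR_eq (n : ℕ) (m : ℤ) (v : E3) :
    realR n m v = (-1) ^ (n + m.natAbs) * solidPolar n m.natAbs v * trigFactor m (azimuth v) := by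
  rw [realR, solidPolar, trigFactor]; ring

/-- The number `ν_n^m` vanishes when `n + m` is odd. -/
lemma coefNu_mul_sign (n : ℕ) (m : ℤ) : coefNu n m * (-1) ^ (n + m.natAbs) = coefNu n m := by
  rcases Int.emod_two_eq_zero_or_one ((n : ℤ) + m) with h | h
  · rw [Even.neg_one_pow, mul_one]
    rw [Nat.even_iff]; omega
  · rw [coefNu, parityL_of_odd h]; ring

lemma termRealU_eq (n : ℕ) (m : ℤ) (x : E3) (k : ℕ) :
    termRealU n m x k = radialTerm n m x k * trigFactor m (azimuth x) := by
  rw [termRealU, realR_eq, radialTerm]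
  have h := coefNu_mul_sign (m.natAbs + k) m
  linear_combination (solidPolar (m.natAbs + k) m.natAbs x * trigFactor m (azimuth x) /
    (((m.natAbs + k : ℕ) : ℝ) + n + 1)) * h

lemma summable_termRealU (n : ℕ) (m : ℤ) {x : E3} (hx : ‖x‖ < 1) : Summable (termRealU n m x) := by
  simp only [funext (termRealU_eq n m x)]
  exact (summable_radialTerm n m hx).mul_right _

lemma realU_mul_realR (n : ℕ) (m : ℤ) (y x : E3) : realU n m x * realR n m y =
    (2 - if m = 0 then 1 else 0) * radialProduct n m y x *
      (trigFactor m (azimuth x) * trigFactor m (azimuth y)) := by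
  rw [realU, funext (termRealU_eq n m x), tsum_mul_right, realR_eq, radialProduct]
  have h := coefNu_mul_sign (n + 1) m
  rw [show n + 1 + m.natAbs = n + m.natAbs + 1 by ring, pow_succ] at h
  linear_combination (((2 - if m = 0 then 1 else 0) / (4 * Real.pi)) * (∑' k, radialTerm n m x k) *
    trigFactor m (azimuth x) * solidPolar n m.natAbs y * trigFactor m (azimuth y)) * h

lemma trigFactor_pair (m : ℤ) (α β : ℝ) :
    (2 - if m = 0 then 1 else 0) * (trigFactor m α * trigFactor m β) +
      (2 - if -m = 0 then 1 else 0) * (trigFactor (-m) α * trigFactor (-m) β) =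
      2 * Real.cos (m * (β - α)) := by
  have hc : Real.cos (m * (β - α)) = Real.cos (m * α) * Real.cos (m * β) +
      Real.sin (m * α) * Real.sin (m * β) := by
    rw [mul_sub, Real.cos_sub]; ring
  rcases lt_trichotomy m 0 with h | rfl | h
  · rw [hc, trigFactor, trigFactor, trigFactor, trigFactor, if_neg (by omega), if_neg (by omega),
      if_neg (by omega), if_neg (by omega), if_pos (by omega), if_pos (by omega)]
    push_cast
    simp only [neg_mul, Real.cos_neg]
    ring
  · simp [trigFactor]; norm_num
  · rw [hc, trigFactor, trigFactor, trigFactor, trigFactor, if_neg (by omega), if_pos (by omega),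
      if_pos (by omega), if_neg (by omega), if_neg (by omega), if_neg (by omega)]
    push_cast
    simp only [neg_mul, Real.sin_neg]
    ring

lemma sum_Icc_neg {α : Type*} [AddCommMonoid α] (n : ℕ) (f : ℤ → α) :
    ∑ m ∈ Finset.Icc (-(n : ℤ)) n, f (-m) = ∑ m ∈ Finset.Icc (-(n : ℤ)) n, f m := by
  refine Finset.sum_nbij' (fun m => -m) (fun m => -m) ?_ ?_ ?_ ?_ ?_ <;> intro m hm <;>
    simp at hm ⊢ <;> omega

/-- The terms of orders `m` and `-m` together agree in the complex and in the real expansion. -/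
lemma sum_coefU_eq (n : ℕ) (y x : E3) :
    ∑ m ∈ Finset.Icc (-(n : ℤ)) n, coefU n m x * regR n m y =
      ((∑ m ∈ Finset.Icc (-(n : ℤ)) n, realU n m x * realR n m y : ℝ) : ℂ) := by
  have hpair : ∀ m : ℤ, coefU n m x * regR n m y + coefU n (-m) x * regR n (-m) y =
      ((realU n m x * realR n m y + realU n (-m) x * realR n (-m) y : ℝ) : ℂ) := by
    intro m
    rw [coefU_mul_regR, coefU_mul_regR, realU_mul_realR, realU_mul_realR, radialProduct_neg]
    have h := trigFactor_pair m (azimuth x) (azimuth y)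
    have h1 : Complex.exp (Complex.I * m * (azimuth y - azimuth x : ℝ)) +
        Complex.exp (Complex.I * (-m : ℤ) * (azimuth y - azimuth x : ℝ)) =
        ((2 * Real.cos (m * (azimuth y - azimuth x)) : ℝ) : ℂ) := by
      push_cast
      rw [Complex.two_cos]
      congr 2 <;> ring
    rw [← mul_add, h1, ← h, ← Complex.ofReal_mul]
    congr 1
    ring
  have h2 : (2 : ℂ) * ∑ m ∈ Finset.Icc (-(n : ℤ)) n, coefU n m x * regR n m y =
      2 * ((∑ m ∈ Finset.Icc (-(n : ℤ)) n, realU n m x * realR n m y : ℝ) : ℂ) := by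
    have e1 := sum_Icc_neg n fun m => coefU n m x * regR n m y
    have e2 := sum_Icc_neg n fun m => realU n m x * realR n m y
    have e3 : ∑ m ∈ Finset.Icc (-(n : ℤ)) n,
        (coefU n m x * regR n m y + coefU n (-m) x * regR n (-m) y) =
        ((∑ m ∈ Finset.Icc (-(n : ℤ)) n,
          (realU n m x * realR n m y + realU n (-m) x * realR n (-m) y) : ℝ) : ℂ) := by
      rw [Complex.ofReal_sum]
      exact Finset.sum_congr rfl fun m _ => hpair m
    rw [Finset.sum_add_distrib, Finset.sum_add_distrib, e1, e2] at e3
    rw [two_mul, e3]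
    push_cast
    ring
  exact mul_left_cancel₀ two_ne_zero h2

lemma hasSum_realU {y x : E3} (hy : ‖y‖ < 1) (hx : ‖x‖ < 1) :
    HasSum (fun n : ℕ => ∑ m ∈ Finset.Icc (-(n : ℤ)) n, realU n m x * realR n m y)
      (kernelTilde y x) :=
  Complex.hasSum_ofReal.1 ((hasSum_coefU hy hx).of_eq (fun n => (sum_coefU_eq n y x).symm) rfl)

/-! ### Symmetry of the coefficients and asymmetry of the kernel -/

/-- The product contains the factor `L_n^m L_{n+1}^m = 0`. -/
lemma coefI_mul_swap (R : ℝ) (m : ℤ) (n n' : ℕ) : coefI R m n' n * coefI R m n n' = 0 := by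
  have h := coefL_mul_succ n m
  rw [coefI, coefI, coefJ, coefJ]
  linear_combination (4 * Real.pi * coefA n' m * coefL (n' + 1) m /
    ((2 * (n : ℝ) + 1) * ((n' : ℝ) + n + 1)) * (R ^ (n' + n + 1))⁻¹ * (4 * Real.pi * coefA n m *
    coefL n' m / ((2 * (n' : ℝ) + 1) * ((n : ℝ) + n' + 1)) * (R ^ (n + n' + 1))⁻¹)) * h

lemma coefL_ne_zero {n : ℕ} {m : ℤ} (h : m.natAbs ≤ n) (hp : ((n : ℤ) + m) % 2 = 0) :
    coefL n m ≠ 0 := by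
  have h1 : normConst n m ≠ 0 := by
    intro h0
    have := normConst_sq (n := n) m
    rw [h0] at this
    have h2 : 0 < (2 * (n : ℝ) + 1) / (4 * Real.pi) *
      (((n - m.natAbs).factorial : ℝ) / ((n + m.natAbs).factorial : ℝ)) := by positivity
    rw [← this] at h2
    simp at h2
  rw [coefL_eq h, parityL_of_even hp]
  positivity

lemma coefI_ne_zero {R : ℝ} (hR : 0 < R) (m : ℤ) : coefI R m (m.natAbs + 1) m.natAbs ≠ 0 := by
  have h1 := coefL_ne_zero (n := m.natAbs + 1 + 1) (m := m) (by omega) (by omega)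
  have h2 := coefL_ne_zero (n := m.natAbs) (m := m) le_rfl (by omega)
  have h3 : coefA (m.natAbs + 1) m ≠ 0 := by
    rw [coefA, if_pos (Nat.le_succ _)]
    have h4 : |(m : ℝ)| = m.natAbs := by rw [Nat.cast_natAbs, Int.cast_abs]
    have h5 := abs_le.1 h4.le
    refine (Real.sqrt_pos.2 ?_).ne'
    push_cast
    have h6 : (0 : ℝ) < (m.natAbs : ℝ) + 1 + 1 + m := by linarith
    have h7 : (0 : ℝ) < (m.natAbs : ℝ) + 1 + 1 - m := by linarith
    positivity
  rw [coefI, coefJ]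
  have := Real.pi_ne_zero
  positivity

/-- The witnesses are a point above the plane and the origin. -/
lemma kernelD_not_symm {R : ℝ} (hR : 0 < R) :
    ∃ y x : E3, ‖y‖ < R ∧ ‖x‖ < R ∧ kernelD R y x ≠ kernelD R x y := by
  have hy : ‖planePoint (0, 0) (R / 2)‖ < R := by
    have : ‖planePoint (0, 0) (R / 2)‖ ^ 2 = (R / 2) ^ 2 := by
      rw [norm_sq_E3]; simp [planePoint]
    rw [← pow_lt_pow_iff_left₀ (norm_nonneg _) hR.le two_ne_zero, this]
    nlinarith
  have hx : ‖(0 : E3)‖ < R := by simpa using hR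
  refine ⟨planePoint (0, 0) (R / 2), 0, hy, hx, ?_⟩
  have h0 : kernelD R 0 (planePoint (0, 0) (R / 2)) = 0 := by
    rw [kernelD_eq hx]
    simp [kernelForm]
  rw [h0]
  intro h
  set y := planePoint (0, 0) (R / 2) with hydef
  have hy2 : y 2 = R / 2 := by simp [hydef, planePoint]
  have hpos : ∀ p ∈ groundSet R, 0 < -kernelForm y 0 p := fun p hp => by
    have h1 := planeDist_pos hx hp
    have h2 := planeDist_pos hy hp
    rw [kernelForm, hy2, ← neg_mul, ← neg_div, neg_neg]
    positivity
  rw [kernelD_eq hy, ← neg_eq_zero, ← integral_neg, setIntegral_eq_zero_iff_of_nonneg_ae] at h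
  · have h3 : ∀ᵐ p ∂(volume : Measure (ℝ × ℝ)), p ∉ groundSet R := by
      have h4 := (ae_restrict_iff' (measurableSet_groundSet R)).1 h
      filter_upwards [h4] with p hp hmem
      exact (hpos p hmem).ne' (hp hmem)
    have h5 : volume (groundSet R) = 0 := by
      rw [ae_iff] at h3
      simpa using h3
    have hopen : IsOpen {p : ℝ × ℝ | R < p.1} := isOpen_lt continuous_const continuous_fst
    have h6 := hopen.measure_pos volume ⟨(R + 1, 0), by simp⟩
    have hsub : {p : ℝ × ℝ | R < p.1} ⊆ groundSet R := fun p hp => by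
      have hp : R < p.1 := hp
      change R ^ 2 ≤ p.1 ^ 2 + p.2 ^ 2
      nlinarith [sq_nonneg p.2]
    exact absurd (measure_mono_null hsub h5) h6.ne'
  · exact (ae_restrict_iff' (measurableSet_groundSet R)).2
      (Filter.Eventually.of_forall fun p hp => (hpos p hp).le)
  · exact (integrableOn_kernelForm hR hy hx).neg

end GroundPlane
theorem mainTheorem3 :
    -- the numbers `L_n^m`
    (∀ (n : ℕ) (m : ℤ), m.natAbs ≤ n →
      (∀ φ : ℝ, sphY n m (Real.pi / 2) φ =
        (coefL n m : ℂ) * Complex.exp (Complex.I * (m : ℂ) * (φ : ℂ))) ∧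
      coefL n m = parityL n m * ((-1) ^ ((n + m.natAbs) / 2) * ((n + m.natAbs).factorial : ℝ) /
        (2 ^ n * (((n - m.natAbs) / 2).factorial : ℝ) * (((n + m.natAbs) / 2).factorial : ℝ))) *
        normConst n m ∧
      coefL n m * coefL (n + 1) m = 0) ∧
    -- expansions of the kernel in the ball of radius `R`
    (∀ R : ℝ, 0 < R → ∀ y x : E3, ‖y‖ < R → ‖x‖ < R →
      IntegrableOn (kernelIntegrand y x) (groundSet R) ∧
      -- sum over `n, m, n', m'`, before the surface integrals are evaluated
      (∀ (n : ℕ) (m : ℤ), m.natAbs ≤ n → Summable (fun n' : ℕ =>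
        ∑ m' ∈ Finset.Icc (-(n' : ℤ)) n',
          ((2 * coefA n' m' / (2 * (n : ℝ) + 1) : ℝ) : ℂ) * regR n (-m) x * regR n' (-m') y *
            ∫ p in groundSet R, singS (n' + 1) m' (planePoint p 0) * singS n m (planePoint p 0))) ∧
      HasSum (fun n : ℕ => ∑ m ∈ Finset.Icc (-(n : ℤ)) n, ∑' n' : ℕ,
        ∑ m' ∈ Finset.Icc (-(n' : ℤ)) n',
          ((2 * coefA n' m' / (2 * (n : ℝ) + 1) : ℝ) : ℂ) * regR n (-m) x * regR n' (-m') y *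
            ∫ p in groundSet R, singS (n' + 1) m' (planePoint p 0) * singS n m (planePoint p 0))
        (kernelD R y x : ℂ) ∧
      -- sum over `n, m, n'` with explicit coefficients
      (∀ (n : ℕ) (m : ℤ), m.natAbs ≤ n → Summable (fun n' : ℕ =>
        (coefI R m n' n : ℂ) * regR n (-m) x * regR n' m y)) ∧
      HasSum (fun n : ℕ => ∑ m ∈ Finset.Icc (-(n : ℤ)) n, ∑' n' : ℕ,
        (coefI R m n' n : ℂ) * regR n (-m) x * regR n' m y) (kernelD R y x : ℂ) ∧
      -- sum over all `m`, over `n = |m| + 1 + q.2.1` and over `n' = |m| + q.2.2`,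
      -- which converges absolutely
      HasSum (fun q : ℤ × ℕ × ℕ =>
        (coefI R q.1 (q.1.natAbs + 1 + q.2.1) (q.1.natAbs + q.2.2) : ℂ) *
          regR (q.1.natAbs + q.2.2) (-q.1) x * regR (q.1.natAbs + 1 + q.2.1) q.1 y)
        (kernelD R y x : ℂ) ∧
      -- reduction to the dimensionless kernel
      kernelD R y x = 1 / R * kernelTilde (R⁻¹ • y) (R⁻¹ • x)) ∧
    -- expansions of the dimensionless kernel, complex and real form
    (∀ y x : E3, ‖y‖ < 1 → ‖x‖ < 1 →
      (∀ (n : ℕ) (m : ℤ), m.natAbs ≤ n → Summable (termU n m x)) ∧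
      HasSum (fun n : ℕ => ∑ m ∈ Finset.Icc (-(n : ℤ)) n, coefU n m x * regR n m y)
        (kernelTilde y x : ℂ) ∧
      (∀ (n : ℕ) (m : ℤ), m.natAbs ≤ n → Summable (termRealU n m x)) ∧
      HasSum (fun n : ℕ => ∑ m ∈ Finset.Icc (-(n : ℤ)) n, realU n m x * realR n m y)
        (kernelTilde y x)) ∧
    -- symmetry in `m`, non-symmetry in `n, n'` and in `y, x`
    (∀ R : ℝ, 0 < R →
      (∀ (m : ℤ) (n n' : ℕ), m.natAbs ≤ n → m.natAbs ≤ n' →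
        coefI R (-m) n n' = coefI R m n n' ∧
        coefI R m m.natAbs n' = 0 ∧
        coefI R m n' n * coefI R m n n' = 0 ∧
        (coefI R m n' n ≠ 0 → coefI R m n' n ≠ coefI R m n n')) ∧
      (∀ m : ℤ, ∃ n n' : ℕ, m.natAbs ≤ n ∧ m.natAbs ≤ n' ∧
        coefI R m n' n ≠ 0 ∧ coefI R m n' n ≠ coefI R m n n') ∧
      ∃ y x : E3, ‖y‖ < R ∧ ‖x‖ < R ∧ kernelD R y x ≠ kernelD R x y) := by
  refine ⟨fun n m h => ⟨sphY_equator n m, coefL_eq h, coefL_mul_succ n m⟩, ?_, ?_, ?_⟩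
  · intro R hR y x hy hx
    have hinner := hasSum_kernelTerm_inner hR hy hx
    have hiter := hasSum_kernelTerm_iterated hR hy hx
    refine ⟨integrableOn_kernelIntegrand hR hy hx, fun n m _ => (hinner (n, m)).summable, hiter,
      fun n m _ => ?_, ?_, hasSum_triple hR hy hx, kernelD_eq_kernelTilde hR hy hx⟩
    · simpa only [sum_kernelTerm hR] using (hinner (n, m)).summable
    · simpa only [sum_kernelTerm hR] using hiter
  · intro y x hy hx
    exact ⟨fun n m _ => summable_termU n m hx, hasSum_coefU hy hx,
      fun n m _ => summable_termRealU n m hx, hasSum_realU hy hx⟩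
  · intro R hR
    have hswap : ∀ (m : ℤ) (n n' : ℕ), coefI R m n' n ≠ 0 → coefI R m n' n ≠ coefI R m n n' := by
      intro m n n' h0 h1
      have h := coefI_mul_swap R m n n'
      rw [← h1] at h
      exact h0 (mul_self_eq_zero.1 h)
    refine ⟨fun m n n' _ _ => ⟨by rw [coefI, coefI, coefJ_neg], coefI_natAbs R m n',
      coefI_mul_swap R m n n', hswap m n n'⟩, fun m => ?_, kernelD_not_symm hR⟩
    exact ⟨m.natAbs, m.natAbs + 1, le_rfl, Nat.le_succ _, coefI_ne_zero hR m,
      hswap m _ _ (coefI_ne_zero hR m)⟩
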